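/- **Setting.** Let a connected conforming triangular mesh in $\mathbb R^3$ be given, with finite vertex set $V$ and finite set $T$ of closed nondegenerate triangles: two distinct triangles are disjoint or meet exactly in a common vertex or a common edge, every vertex belongs to some triangle, and any two vertices are joined by a path of edges. The vertices of $f\in T$ are ordered as $v_1^f,v_2^f,v_3^f$; $|f|$ is the area of $f$ and $|v|=\frac13\sum_{f\ni v}|f|$. Let $N\ge 1$, let $k\in\{0,\dots,N\}$ index the centered time grid and $k\in\{\frac12,\frac32,\dots,N-\frac12\}$ the staggered one. Let $\mu_0,\mu_N\in\mathbb R_+^{V}$ satisfy $\sum_v|v|\mu_{0,v}=\sum_v|v|\mu_{N,v}=1$. *Inner products.* For vectors indexed by time and vertices, $\langle x,y\rangle_{t,V}=\frac1N\sum_{k,v}|v|x_{k,v}y_{k,v}$; for $\mathbb R^3$-valued ones indexed by time and triangles, $\langle x,y\rangle_{t,T}=\frac1N\sum_{k,f}|f|x_{k,f}^\top y_{k,f}$. Let $\mathcal W_{c,V}$ be the diagonal weight matrix of $\langle\cdot,\cdot\rangle_{t,V}$ on centered time. For $q=(A;B)$, with $A$ on staggered time $\times V$ and $B$ being $\mathbb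 R^3$-valued on centered time $\times T$, and for $z=(z_1;(z_{2,s,i})_{s\in\{+,-\},\,i=1,2,3};z_3)$, with $z_1,z_3$ on staggered time $\times V$ and $z_{2,s,i}$ being $\mathbb R^3$-valued on staggered time $\times T$, let $\langle\cdot,\cdot\rangle_q$ and $\langle\cdot,\cdot\rangle_z$ be the sums of these inner products over the components, $\|\cdot\|_q,\|\cdot\|_z$ the induced norms, and $\mathcal W_q,\mathcal W_z$ the diagonal weight matrices. All adjoints $(\cdot)^*$ are matrix transposes. *Operators.* For $\varphi$ on centered time $\times V$ put $\mathcal A\varphi=(A;B)$ with $A_{k,v}=N(\varphi_{k+1/2,v}-\varphi_{k-1/2,v})$ and $B_{k,f}=\sum_{i=1}^3\varphi_{k,v_i^f}\nabla h_{v_i^f}|_f$, where $h_v$ is the piecewise linear hat function of $v$ and $\nabla$ is the gradient within the plane of $f$. Let $\mathcal B\mathcal F(A;B)=(-A;\frac{\sqrt3}{3}D;A)$ with $(D_{+,i})_{k,f}=B_{k-1/2,f}$ and $(D_{-,i})_{k,f}=B_{k+1/2,f}$ for $i=1,2,3$, and $d=(1;0;1)$. For staggered $k$ and $v\in V$ let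 $\mathcal T^{k,v}z$ be the vector made of, in this order, $(z_1)_{k,v}$, all $\sqrt{|f|/|v|}\,(z_{2,s,i})_{k,f}$ with $s\in\{+,-\}$, $i\in\{1,2,3\}$ and $v_i^f=v$, and $(z_3)_{k,v}$. Let $\mathcal Tz=(\mathcal T^{k,v}z)_{k,v}$ and let $\mathbb Q$ be the product over all $(k,v)$ of the second-order cones $\{(y_0;\bar y): y_0\ge\|\bar y\|\}$. Let $c$ be the vector with $\langle\varphi,c\rangle_{t,V}=\sum_v|v|\varphi_{0,v}\mu_{0,v}-\sum_v|v|\varphi_{N,v}\mu_{N,v}$ for all $\varphi$. *KKT system.* For the second-order cone program $\min\{\langle\varphi,c\rangle_{t,V}:\mathcal A\varphi=q,\ \mathcal B\mathcal Fq+d=z,\ \mathcal Tz\in\mathbb Q\}$, with multipliers $\alpha$ (indexed like $q$) and $\beta$ (indexed like $z$), the KKT system is $$\mathcal A\varphi=q,\quad \mathcal B\mathcal Fq+d=z,\quad \mathcal W_{c,V}c+\mathcal A^*\mathcal W_q\alpha=0,\quad \mathcal W_q\alpha+\mathcal F^*\mathcal B^*\mathcal W_z\beta=0,$$ $$\mathcal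 Tz\in\mathbb Q,\quad \mathcal W_z\beta\in\mathcal T^*\mathbb Q,\quad \langle\beta,z\rangle_z=0.$$ *Algorithm 1* (inexact semi-proximal augmented Lagrangian method). With the indicator function $\delta_{\mathbb Q}$ and $$\mathcal L_\sigma(\varphi,z,q;\alpha,\beta)=\langle c,\varphi\rangle_{t,V}+\delta_{\mathbb Q}(\mathcal Tz)+\langle\mathcal A\varphi-q,\alpha\rangle_q+\langle z-\mathcal B\mathcal Fq-d,\beta\rangle_z+\tfrac\sigma2\|\mathcal A\varphi-q\|_q^2+\tfrac\sigma2\|z-\mathcal B\mathcal Fq-d\|_z^2,$$ given $\sigma>0$, $\tau\in(0,2)$ and arbitrary $q^{(0)},\alpha^{(0)},\beta^{(0)}$, the algorithm iterates for $l=0,1,2,\dots$: $$\begin{aligned}(\varphi^{(l+1)},z^{(l+1)})&\in\arg\min_{\varphi,z}\{\mathcal L_\sigma(\varphi,z,q^{(l)};\alpha^{(l)},\beta^{(l)}):\varphi\in\operatorname{rge}(\mathcal A^*)\},\\ q^{(l+1)}&\in\arg\min_q\mathcal L_\sigma(\varphi^{(l+1)},z^{(l+1)},q;\alpha^{(l)},\beta^{(l)}),\\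 \alpha^{(l+1)}&=\alpha^{(l)}+\tau\sigma(\mathcal A\varphi^{(l+1)}-q^{(l+1)}),\\ \beta^{(l+1)}&=\beta^{(l)}+\tau\sigma(z^{(l+1)}-\mathcal B\mathcal Fq^{(l+1)}-d).\end{aligned}$$ **Theorem 1.** For every such mesh, $N$, $\mu_0,\mu_N$, every $\sigma>0$, $\tau\in(0,2)$ and every initial point $(q^{(0)},\alpha^{(0)},\beta^{(0)})$, Algorithm 1 generates an infinite sequence (the minimizers in its steps exist), and the whole sequence $(\varphi^{(l)};z^{(l)};q^{(l)};\alpha^{(l)};\beta^{(l)})$ converges, as $l\to\infty$, to a solution of the KKT system above. -/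

import Mathlib

open Filter Topology Matrix
open scoped Kronecker

noncomputable section

namespace SurfaceDOT

/-- A finite triangular mesh in `ℝ³`: vertices are indexed by `V`, closed triangles by `T`;
`vert f i` is the `i`-th vertex of the triangle `f` in a chosen order. -/
structure TriMesh (V T : Type*) where
  pos : V → EuclideanSpace ℝ (Fin 3)
  vert : T → Fin 3 → V
  pos_injective : Function.Injective pos
  /-- the triangles are not degenerate -/
  nondegenerate : ∀ f, AffineIndependent ℝ (fun i => pos (vert f i))
  /-- two distinct triangles are disjoint or meet exactly in a common vertex or a common edge -/
  conforming : ∀ f g, f ≠ g →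
    convexHull ℝ (Set.range fun i => pos (vert f i)) ∩
        convexHull ℝ (Set.range fun i => pos (vert g i)) = ∅ ∨
    (∃ i j, vert f i = vert g j ∧
      convexHull ℝ (Set.range fun i => pos (vert f i)) ∩
        convexHull ℝ (Set.range fun i => pos (vert g i)) = {pos (vert f i)}) ∨
    (∃ i i' j j', i ≠ i' ∧ vert f i = vert g j ∧ vert f i' = vert g j' ∧
      convexHull ℝ (Set.range fun i => pos (vert f i)) ∩
        convexHull ℝ (Set.range fun i => pos (vert g i)) =
          segment ℝ (pos (vert f i)) (pos (vert f i')))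
  /-- every vertex is a vertex of some triangle -/
  covered : ∀ v, ∃ f i, vert f i = v
  /-- the mesh is connected: any two vertices are joined by a path of edges -/
  connected : (SimpleGraph.fromRel fun v w : V => ∃ f i j, vert f i = v ∧ vert f j = w).Connected

/-! Index sets. The centered time grid `{k/N : k = 0, …, N}` is indexed by `Fin (N+1)`, the
staggered grid `{k/N : k = 1/2, 3/2, …, N - 1/2}` by `Fin N`, the index `j` standing for
`k = j + 1/2`. -/

/-- index set of `φ` -/
abbrev PhiIdx (V : Type*) (N : ℕ) := Fin (N + 1) × V

/-- index set of quantities on staggered time × vertices -/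
abbrev StV (V : Type*) (N : ℕ) := Fin N × V

/-- index set of `ℝ³`-valued quantities on centered time × triangles -/
abbrev CT (T : Type*) (N : ℕ) := Fin (N + 1) × (T × Fin 3)

/-- index set of `ℝ³`-valued quantities on staggered time × triangles -/
abbrev StT (T : Type*) (N : ℕ) := Fin N × (T × Fin 3)

/-- index set of `q = (A; B)` and of the multiplier `α = (α₁; α₂)` -/
abbrev QIdx (V T : Type*) (N : ℕ) := StV V N ⊕ CT T N

/-- index set of the six copies `(D₁⁺; D₂⁺; D₃⁺; D₁⁻; D₂⁻; D₃⁻)`: the first factor is `0` for `+`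
and `1` for `-` -/
abbrev SixIdx (T : Type*) (N : ℕ) := (Fin 2 × Fin 3) × StT T N

/-- index set of `ℱ q` -/
abbrev FIdx (V T : Type*) (N : ℕ) := StV V N ⊕ SixIdx T N

/-- index set of `z = (z₁; z₂; z₃)` and of the multiplier `β = (β₁; β₂; β₃)` -/
abbrev ZIdx (V T : Type*) (N : ℕ) := StV V N ⊕ (SixIdx T N ⊕ StV V N)

variable {V T : Type*} [Fintype V] [DecidableEq V] [Fintype T] [DecidableEq T]

instance (N : ℕ) : DecidableEq (SixIdx T N) := instDecidableEqProd

instance (N : ℕ) : DecidableEq (ZIdx V T N) := instDecidableEqSum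

/-- The Jacobian `J = (v₂ - v₁, v₃ - v₁)` of the parametrization of a triangle. -/
def TriMesh.jac (M : TriMesh V T) (f : T) : Matrix (Fin 3) (Fin 2) ℝ :=
  Matrix.of fun d j => M.pos (M.vert f j.succ) d - M.pos (M.vert f 0) d

/-- The area `|f|` of a triangle: half the area of the parallelogram spanned by two edges. -/
def TriMesh.area (M : TriMesh V T) (f : T) : ℝ :=
  Real.sqrt ((M.jac f)ᵀ * M.jac f).det / 2

/-- The area `|v|` of the barycentric dual cell of a vertex: a third of the total area of the
triangles that have `v` as a vertex. -/
def TriMesh.vertexArea (M : TriMesh V T) (v : V) : ℝ :=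
  (1 / 3) * ∑ f with ∃ i, M.vert f i = v, M.area f

/-- The `3 × 3` matrix whose `i`-th column is the gradient on `f` of the hat function of the `i`-th
vertex of `f`, that is `J (Jᵀ J)⁻¹ (-1 1 0; -1 0 1)`. -/
def TriMesh.gradHat (M : TriMesh V T) (f : T) : Matrix (Fin 3) (Fin 3) ℝ :=
  M.jac f * ((M.jac f)ᵀ * M.jac f)⁻¹ *
    (!![-1, 1, 0; -1, 0, 1] : Matrix (Fin 2) (Fin 3) ℝ)

/-- The spatial gradient `(Ã_s γ)_f = ∑_{v ∈ V_f} γ_v ∇h_v`. -/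
def TriMesh.spaceGrad (M : TriMesh V T) : Matrix (T × Fin 3) V ℝ :=
  Matrix.of fun p v => ∑ i with M.vert p.1 i = v, M.gradHat p.1 p.2 i

/-- `𝒞₊ = (I 0)` -/
def copyPlus (N : ℕ) : Matrix (Fin N) (Fin (N + 1)) ℝ :=
  Matrix.of fun j k => if k = j.castSucc then 1 else 0

/-- `𝒞₋ = (0 I)` -/
def copyMinus (N : ℕ) : Matrix (Fin N) (Fin (N + 1)) ℝ :=
  Matrix.of fun j k => if k = j.succ then 1 else 0

/-- The temporal difference `(Ã_t ζ)_k = N (ζ_{k+1/2} - ζ_{k-1/2})`. -/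
def timeDiff (N : ℕ) : Matrix (Fin N) (Fin (N + 1)) ℝ :=
  (N : ℝ) • (copyMinus N - copyPlus N)

/-- The discrete gradient `𝒜 = (Ã_t ⊗ I; I ⊗ Ã_s)`. -/
def TriMesh.opA (M : TriMesh V T) (N : ℕ) : Matrix (QIdx V T N) (PhiIdx V N) ℝ :=
  Matrix.fromRows (timeDiff N ⊗ₖ (1 : Matrix V V ℝ))
    ((1 : Matrix (Fin (N + 1)) (Fin (N + 1)) ℝ) ⊗ₖ M.spaceGrad)

/-- `ℱ̃`: three copies of `𝒞₊ ⊗ I` followed by three copies of `𝒞₋ ⊗ I`. -/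
def opFtilde (T : Type*) [DecidableEq T] (N : ℕ) : Matrix (SixIdx T N) (CT T N) ℝ :=
  Matrix.of fun p b =>
    ((if p.1.1 = 0 then copyPlus N else copyMinus N) ⊗ₖ
      (1 : Matrix (T × Fin 3) (T × Fin 3) ℝ)) p.2 b

/-- `ℱ = Diag(I, ℱ̃)` -/
def opF (V T : Type*) [DecidableEq V] [DecidableEq T] (N : ℕ) :
    Matrix (FIdx V T N) (QIdx V T N) ℝ :=
  Matrix.fromBlocks 1 0 0 (opFtilde T N)

/-- `ℬ (A; D) = (-A; (√3/3) D; A)` -/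
def opB (V T : Type*) [DecidableEq V] [DecidableEq T] (N : ℕ) :
    Matrix (ZIdx V T N) (FIdx V T N) ℝ :=
  Matrix.fromRows (Matrix.fromCols (-1) 0)
    (Matrix.fromRows (Matrix.fromCols 0 ((Real.sqrt 3 / 3) • 1)) (Matrix.fromCols 1 0))

/-- The shift vector `d = (1; 0; 1)`. -/
def shift (V T : Type*) (N : ℕ) : ZIdx V T N → ℝ :=
  Sum.elim 1 (Sum.elim 0 1)

/-! Weights and weighted inner products. -/

/-- `𝒲_{c,V}` -/
def TriMesh.WcV (M : TriMesh V T) (N : ℕ) : Matrix (PhiIdx V N) (PhiIdx V N) ℝ :=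
  (1 / (N : ℝ)) • ((1 : Matrix (Fin (N + 1)) (Fin (N + 1)) ℝ) ⊗ₖ Matrix.diagonal M.vertexArea)

/-- `𝒲_{st,V}` -/
def TriMesh.WstV (M : TriMesh V T) (N : ℕ) : Matrix (StV V N) (StV V N) ℝ :=
  (1 / (N : ℝ)) • ((1 : Matrix (Fin N) (Fin N) ℝ) ⊗ₖ Matrix.diagonal M.vertexArea)

/-- `𝒲_{c,T}` -/
def TriMesh.WcT (M : TriMesh V T) (N : ℕ) : Matrix (CT T N) (CT T N) ℝ :=
  (1 / (N : ℝ)) • ((1 : Matrix (Fin (N + 1)) (Fin (N + 1)) ℝ) ⊗ₖ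
    (Matrix.diagonal M.area ⊗ₖ (1 : Matrix (Fin 3) (Fin 3) ℝ)))

/-- `𝒲_{st,T}` -/
def TriMesh.WstT (M : TriMesh V T) (N : ℕ) : Matrix (StT T N) (StT T N) ℝ :=
  (1 / (N : ℝ)) • ((1 : Matrix (Fin N) (Fin N) ℝ) ⊗ₖ
    (Matrix.diagonal M.area ⊗ₖ (1 : Matrix (Fin 3) (Fin 3) ℝ)))

/-- `Diag(𝒲_{st,V}, 𝒲_{c,T})`, the weight of the inner product `⟨·,·⟩_q` -/
def TriMesh.Wq (M : TriMesh V T) (N : ℕ) : Matrix (QIdx V T N) (QIdx V T N) ℝ :=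
  Matrix.fromBlocks (M.WstV N) 0 0 (M.WcT N)

/-- `Diag(𝒲_{st,V}, I₆ ⊗ 𝒲_{st,T}, 𝒲_{st,V})`, the weight of the inner product `⟨·,·⟩_z` -/
def TriMesh.Wz (M : TriMesh V T) (N : ℕ) : Matrix (ZIdx V T N) (ZIdx V T N) ℝ :=
  Matrix.fromBlocks (M.WstV N) 0 0
    (Matrix.fromBlocks ((1 : Matrix (Fin 2 × Fin 3) (Fin 2 × Fin 3) ℝ) ⊗ₖ M.WstT N) 0 0 (M.WstV N))

/-- The inner product `⟨x, y⟩ = xᵀ W y` with weight matrix `W`. -/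
def wInner {ι : Type*} [Fintype ι] (W : Matrix ι ι ℝ) (x y : ι → ℝ) : ℝ :=
  x ⬝ᵥ (W *ᵥ y)

/-- Discrete probability densities on the mesh. -/
def TriMesh.IsDensity (M : TriMesh V T) (μ : V → ℝ) : Prop :=
  (∀ v, 0 ≤ μ v) ∧ ∑ v, M.vertexArea v * μ v = 1

/-- The vector `c` with
`⟨φ, c⟩_{t,V} = ∑ v, |v| φ_{0,v} μ_{0,v} - ∑ v, |v| φ_{N,v} μ_{N,v}`. -/
def costVec (N : ℕ) (μ₀ μ₁ : V → ℝ) : PhiIdx V N → ℝ := fun p =>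
  (N : ℝ) * ((if p.1 = 0 then μ₀ p.2 else 0) - (if p.1 = Fin.last N then μ₁ p.2 else 0))

/-! Second-order cones and the operator `𝒯`. -/

/-- The second-order cone `{(y₀; ȳ) : y₀ ≥ ‖ȳ‖}`, with the Euclidean norm. -/
def soc (ι : Type*) [Fintype ι] : Set (Unit ⊕ ι → ℝ) :=
  {y | Real.sqrt (∑ i, y (Sum.inr i) ^ 2) ≤ y (Sum.inl ())}

/-- The coordinates of the tail `ȳ` in the block of a vertex `v`: for each sign and each `i`, three
coordinates for each triangle whose `i`-th vertex is `v`, and a last coordinate. -/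
abbrev TriMesh.Tail (M : TriMesh V T) (v : V) :=
  (Fin 2 × (Σ i : Fin 3, {f : T // M.vert f i = v}) × Fin 3) ⊕ Unit

/-- index set of `𝒯 z`: one block for each pair of a staggered time and a vertex -/
abbrev TriMesh.TIdx (M : TriMesh V T) (N : ℕ) := Σ p : StV V N, Unit ⊕ M.Tail p.2

/-- The operator `𝒯`: its `(k,v)`-block selects the first component `z₁` at `(k,v)`, the components
of `z₂` at time `k` on the triangles around `v` (in the `i`-th copies those whose `i`-th vertex
is `v`), scaled by `√(|f|/|v|)`, and the component of `z₃` at `(k,v)`. -/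
def TriMesh.opT (M : TriMesh V T) (N : ℕ) : Matrix (M.TIdx N) (ZIdx V T N) ℝ :=
  Matrix.of fun r => match r with
    | ⟨p, Sum.inl _⟩ => Pi.single (Sum.inl p) 1
    | ⟨p, Sum.inr (Sum.inl (s, ⟨i, f⟩, d))⟩ =>
        Pi.single (Sum.inr (Sum.inl ((s, i), (p.1, (f.1, d)))))
          (Real.sqrt (M.area f.1 / M.vertexArea p.2))
    | ⟨p, Sum.inr (Sum.inr _)⟩ => Pi.single (Sum.inr (Sum.inr p)) 1

/-- The product `ℚ` of the second-order cones over all blocks. -/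
def TriMesh.coneQ (M : TriMesh V T) (N : ℕ) : Set (M.TIdx N → ℝ) :=
  {u | ∀ p : StV V N, (fun b => u ⟨p, b⟩) ∈ soc (M.Tail p.2)}

/-- The KKT system of the second-order cone program
`min ⟨φ, c⟩_{t,V}` subject to `𝒜 φ = q`, `ℬ ℱ q + d = z`, `𝒯 z ∈ ℚ`. -/
structure TriMesh.IsKKT (M : TriMesh V T) (N : ℕ) (μ₀ μ₁ : V → ℝ)
    (φ : PhiIdx V N → ℝ) (z : ZIdx V T N → ℝ) (q : QIdx V T N → ℝ)
    (α : QIdx V T N → ℝ) (β : ZIdx V T N → ℝ) : Prop where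
  feas_q : M.opA N *ᵥ φ = q
  feas_z : opB V T N *ᵥ (opF V T N *ᵥ q) + shift V T N = z
  stat_phi : M.WcV N *ᵥ costVec N μ₀ μ₁ + (M.opA N)ᵀ *ᵥ (M.Wq N *ᵥ α) = 0
  stat_q : M.Wq N *ᵥ α + (opF V T N)ᵀ *ᵥ ((opB V T N)ᵀ *ᵥ (M.Wz N *ᵥ β)) = 0
  cone_z : M.opT N *ᵥ z ∈ M.coneQ N
  cone_beta : M.Wz N *ᵥ β ∈ (fun u => (M.opT N)ᵀ *ᵥ u) '' M.coneQ N
  compl : wInner (M.Wz N) β z = 0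

open Classical in
/-- The indicator function of a set in the sense of convex analysis. -/
def indicatorFn {X : Type*} (S : Set X) (x : X) : EReal := if x ∈ S then 0 else ⊤

/-- The augmented Lagrangian with penalty parameter `σ`. -/
def TriMesh.augLagrangian (M : TriMesh V T) (N : ℕ) (μ₀ μ₁ : V → ℝ) (σ : ℝ)
    (φ : PhiIdx V N → ℝ) (z : ZIdx V T N → ℝ) (q : QIdx V T N → ℝ)
    (α : QIdx V T N → ℝ) (β : ZIdx V T N → ℝ) : EReal :=
  let rq := M.opA N *ᵥ φ - q
  let rz := z - opB V T N *ᵥ (opF V T N *ᵥ q) - shift V T N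
  ((wInner (M.WcV N) (costVec N μ₀ μ₁) φ + wInner (M.Wq N) rq α + wInner (M.Wz N) rz β
    + σ / 2 * wInner (M.Wq N) rq rq + σ / 2 * wInner (M.Wz N) rz rz : ℝ) : EReal)
    + indicatorFn (M.coneQ N) (M.opT N *ᵥ z)

/-- `x` is a minimizer of `g` over the set `S`. -/
def IsArgMin {X : Type*} (g : X → EReal) (S : Set X) (x : X) : Prop :=
  x ∈ S ∧ ∀ y ∈ S, g x ≤ g y

/-- The sequences `φ, z, q, α, β` are generated by the inexact semi-proximal augmented Lagrangian
method with penalty parameter `σ`, step length `τ` and initial point `(q⁰, α⁰, β⁰)`. The method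
uses neither `φ 0` nor `z 0`. -/
structure TriMesh.IsGenerated (M : TriMesh V T) (N : ℕ) (μ₀ μ₁ : V → ℝ) (σ τ : ℝ)
    (q₀ α₀ : QIdx V T N → ℝ) (β₀ : ZIdx V T N → ℝ)
    (φ : ℕ → PhiIdx V N → ℝ) (z : ℕ → ZIdx V T N → ℝ) (q : ℕ → QIdx V T N → ℝ)
    (α : ℕ → QIdx V T N → ℝ) (β : ℕ → ZIdx V T N → ℝ) : Prop where
  init_q : q 0 = q₀
  init_alpha : α 0 = α₀
  init_beta : β 0 = β₀
  /-- joint minimization in `(φ, z)` over `φ ∈ rge 𝒜*` -/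
  step_phi_z : ∀ l, IsArgMin
    (fun p : (PhiIdx V N → ℝ) × (ZIdx V T N → ℝ) =>
      M.augLagrangian N μ₀ μ₁ σ p.1 p.2 (q l) (α l) (β l))
    {p | p.1 ∈ Set.range fun w => (M.opA N)ᵀ *ᵥ w} (φ (l + 1), z (l + 1))
  step_q : ∀ l, IsArgMin
    (fun q' => M.augLagrangian N μ₀ μ₁ σ (φ (l + 1)) (z (l + 1)) q' (α l) (β l))
    Set.univ (q (l + 1))
  step_alpha : ∀ l, α (l + 1) = α l + (τ * σ) • (M.opA N *ᵥ φ (l + 1) - q (l + 1))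
  step_beta : ∀ l, β (l + 1) = β l +
    (τ * σ) • (z (l + 1) - opB V T N *ᵥ (opF V T N *ᵥ q (l + 1)) - shift V T N)

end SurfaceDOT

end

/-! In the inner product ⟨·,·⟩_q + ⟨·,·⟩_z, made Euclidean by `TriMesh.embed`, the cone program
seeks a point p = (𝒜φ, z) of the closed convex set D given by 𝒯z ∈ ℚ (`primalSet`) that has the form
s + b, where s = (q, ℬℱq) lies in a subspace R and b = (0, d). Stationarity at a KKT point turns the
cost ⟨φ, c⟩ into a linear functional of p. Algorithm 1 is then a two-block alternating direction
method: minimize over D, minimize over R, and move the multiplier y by τσ times the residual r = p -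
s - b.

Convergence for all τ in (0,2) rests on the second block being a subspace without further cost. Its
optimality puts y + σr in Rᗮ, so the component of y in R is multiplied by 1 - τ in each iteration. A
multiple of its squared norm, added to the usual Lyapunov function, absorbs the one cross term
without a sign (`IsSplitting.descent`). Residuals and increments therefore vanish, a cluster point
is a saddle point, and the monotone Lyapunov function centred there tends to 0, so the whole
sequence converges (`IsSplitting.tendsto`).

A KKT point must exist for this (`exists_isKKT`). The dual has a Slater point: spread the initial
mass evenly over the vertices at time 0, leave it at rest, and gather it at the final time;
connectedness of the mesh provides the momentum. This makes the cost coercive on the cone, so the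
minimum is attained. A Slater point of the primal then gives a multiplier by Hahn-Banach separation.
Since 𝒯 is a positive diagonal matrix up to reindexing, 𝒯*ℚ is a dual cone, and saddle points and
KKT points correspond. Finally, 𝒜 is injective on rge 𝒜*, so convergence of 𝒜φ gives convergence of
φ. -/

namespace SurfaceDOT

/-! ### Convergence of the alternating direction method in a Euclidean space

The problem is to minimize `⟪g, p⟫` over `p ∈ D ∩ (R + b)` for a closed convex set `D` and a
subspace `R`. -/

section Splitting

variable {Y : Type*} [NormedAddCommGroup Y] [InnerProductSpace ℝ Y]

/-- Saddle points of the Lagrangian `⟪g, p⟫ + ⟪p - s - b, y⟫` over `p ∈ D`, `s ∈ R`. -/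
structure IsSaddle (D : Set Y) (R : Submodule ℝ Y) (g b p s y : Y) : Prop where
  mem : p ∈ D
  mem_range : s ∈ R
  feas : p = s + b
  dual : y ∈ Rᗮ
  opt : ∀ x ∈ D, 0 ≤ inner ℝ (x - p) (g + y)

/-- The optimality conditions of the steps of the alternating direction method. -/
structure IsSplitting (D : Set Y) (R : Submodule ℝ Y) (g b : Y) (σ τ : ℝ) (p s y : ℕ → Y) :
    Prop where
  mem : ∀ l, p (l + 1) ∈ D
  opt : ∀ l, ∀ x ∈ D, 0 ≤ inner ℝ (x - p (l + 1)) (g + y l + σ • (p (l + 1) - s l - b))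
  mem_range : ∀ l, s l ∈ R
  ortho : ∀ l, y l + σ • (p (l + 1) - s (l + 1) - b) ∈ Rᗮ
  step : ∀ l, y (l + 1) = y l + (τ * σ) • (p (l + 1) - s (l + 1) - b)

/-- The quadratic function `⟪x, g⟫ + σ / 2 * ‖x - w‖ ^ 2`. -/
noncomputable def quad (σ : ℝ) (g w x : Y) : ℝ := inner ℝ x g + σ / 2 * ‖x - w‖ ^ 2

/-- The exact second-order expansion at p, with gradient g + σ(p - w). The positive remainder gives
both sufficiency of the variational inequality and uniqueness of minimizers. -/
lemma quad_eq (σ : ℝ) (g w x p : Y) :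
    quad σ g w x = quad σ g w p + inner ℝ (x - p) (g + σ • (p - w)) + σ / 2 * ‖x - p‖ ^ 2 := by
  unfold quad
  have e : x - w = (p - w) + (x - p) := by abel
  rw [e, norm_add_sq_real, inner_add_right, inner_smul_right, inner_sub_left x p g,
    real_inner_comm (x - p)]
  ring

variable [FiniteDimensional ℝ Y]

/-- The Lyapunov function of the alternating direction method. -/
noncomputable def lyapunov (R : Submodule ℝ Y) (σ τ : ℝ) (s' y' s y : Y) : ℝ :=
  ‖y - y'‖ ^ 2 / (τ * σ) + σ * ‖s - s'‖ ^ 2 + 2 / (σ * τ * (2 - τ)) * ‖R.starProjection y‖ ^ 2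

lemma lyapunov_nonneg (R : Submodule ℝ Y) {σ τ : ℝ} (hσ : 0 < σ) (hτ : τ ∈ Set.Ioo (0 : ℝ) 2)
    (s' y' s y : Y) : 0 ≤ lyapunov R σ τ s' y' s y := by
  have h0 := hτ.1
  have h2 : 0 < 2 - τ := by linarith [hτ.2]
  unfold lyapunov
  positivity

lemma norm_sq_le_lyapunov (R : Submodule ℝ Y) {σ τ : ℝ} (hσ : 0 < σ)
    (hτ : τ ∈ Set.Ioo (0 : ℝ) 2) (s' y' s y : Y) :
    ‖y - y'‖ ^ 2 ≤ τ * σ * lyapunov R σ τ s' y' s y ∧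
      ‖s - s'‖ ^ 2 ≤ σ⁻¹ * lyapunov R σ τ s' y' s y := by
  have h0 := hτ.1
  have h2 : 0 < 2 - τ := by linarith [hτ.2]
  have e1 : 0 ≤ ‖y - y'‖ ^ 2 / (τ * σ) := by positivity
  have e2 : 0 ≤ σ * ‖s - s'‖ ^ 2 := by positivity
  have e3 : 0 ≤ 2 / (σ * τ * (2 - τ)) * ‖R.starProjection y‖ ^ 2 := by positivity
  constructor
  · rw [← div_le_iff₀' (by positivity)]
    unfold lyapunov
    linarith
  · rw [inv_mul_eq_div, le_div_iff₀' hσ]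
    unfold lyapunov
    linarith

namespace IsSplitting

variable {D : Set Y} {R : Submodule ℝ Y} {g b : Y} {σ τ : ℝ} {p s y : ℕ → Y}

/-- The new multiplier is a combination, with weights 1 - τ and τ, of the old one and a vector of
Rᗮ. As |1 - τ| < 1, dual infeasibility decays geometrically. -/
lemma starProjection_succ (h : IsSplitting D R g b σ τ p s y) (l : ℕ) :
    R.starProjection (y (l + 1)) = (1 - τ) • R.starProjection (y l) := by
  have h1 : R.starProjection (y l + σ • (p (l + 1) - s (l + 1) - b)) = 0 :=
    (Submodule.starProjection_apply_eq_zero_iff R).2 (h.ortho l)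
  have h2 : y (l + 1) = (1 - τ) • y l + τ • (y l + σ • (p (l + 1) - s (l + 1) - b)) := by
    rw [h.step]; module
  rw [h2, map_add, map_smul, map_smul, h1, smul_zero, add_zero]

lemma descent (h : IsSplitting D R g b σ τ p s y) (hσ : 0 < σ) (hτ : τ ∈ Set.Ioo (0 : ℝ) 2)
    {p' s' y' : Y} (h' : IsSaddle D R g b p' s' y') (l : ℕ) :
    lyapunov R σ τ s' y' (s (l + 1)) (y (l + 1)) +
      (2 - τ) * σ * ‖p (l + 1) - s (l + 1) - b‖ ^ 2 + σ / 2 * ‖s (l + 1) - s l‖ ^ 2 ≤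
      lyapunov R σ τ s' y' (s l) (y l) := by
  have h0 := hτ.1
  have h2 : 0 < 2 - τ := by linarith [hτ.2]
  have hopt := h.opt l p' h'.mem
  have hopt' := h'.opt _ (h.mem l)
  have hproj : ‖R.starProjection (y (l + 1))‖ ^ 2 = (1 - τ) ^ 2 * ‖R.starProjection (y l)‖ ^ 2 := by
    rw [h.starProjection_succ, norm_smul, mul_pow, Real.norm_eq_abs, sq_abs]
  have hδmem : s (l + 1) - s l ∈ R := R.sub_mem (h.mem_range _) (h.mem_range _)
  have humem : s (l + 1) - s' ∈ R := R.sub_mem (h.mem_range _) h'.mem_range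
  have hu := (Submodule.mem_orthogonal R _).1 (h.ortho l) _ humem
  have hδ := (Submodule.mem_orthogonal R _).1 (h.ortho l) _ hδmem
  have hu' := (Submodule.mem_orthogonal R _).1 h'.dual _ humem
  have hP : inner ℝ (s (l + 1) - s l) (y l) =
      inner ℝ (s (l + 1) - s l) (R.starProjection (y l)) := by
    rw [← Submodule.inner_starProjection_left_eq_right,
      Submodule.starProjection_eq_self_iff.2 hδmem]
  have hcs := real_inner_le_norm (s (l + 1) - s l) (R.starProjection (y l))
  rw [← hP] at hcs
  have hp : p (l + 1) - p' = (p (l + 1) - s (l + 1) - b) + (s (l + 1) - s') := by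
    rw [h'.feas]; abel
  have hp0 : p (l + 1) - s l - b = (p (l + 1) - s (l + 1) - b) + (s (l + 1) - s l) := by abel
  have hy1 : y (l + 1) - y' = (y l - y') + (τ * σ) • (p (l + 1) - s (l + 1) - b) := by
    rw [h.step]; abel
  have hs0 : s l - s' = (s (l + 1) - s') - (s (l + 1) - s l) := by abel
  have hp' : p' - p (l + 1) = -(p (l + 1) - p') := by abel
  have hyl : y l = (y l - y') + y' := by abel
  unfold lyapunov
  rw [hproj, hy1, hs0]
  rw [hp', hp0, hp] at hopt
  rw [hp] at hopt'
  set r := p (l + 1) - s (l + 1) - b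
  set δ := s (l + 1) - s l
  set u := s (l + 1) - s'
  set π := ‖R.starProjection (y l)‖
  rw [norm_add_sq_real, norm_sub_sq_real u δ, norm_smul, Real.norm_eq_abs, mul_pow, sq_abs,
    inner_smul_right]
  simp only [inner_neg_left, inner_add_left, inner_add_right, inner_smul_right,
    real_inner_self_eq_norm_sq, inner_sub_left] at hopt hopt' hu hδ hu' ⊢
  rw [real_inner_comm r (y l), real_inner_comm r y']
  -- Sum of the two variational inequalities, with p (l + 1) - p' = r + u. Orthogonality removes the
  -- pairings of u with multipliers and replaces σ⟨r, δ⟩ by -⟨δ, y l⟩, which only sees the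
  -- projection of y l to R.
  have key : inner ℝ r (y l) - inner ℝ r y' + σ * ‖r‖ ^ 2 + σ * inner ℝ u δ ≤ ‖δ‖ * π := by
    rw [real_inner_comm r δ] at hδ
    linarith
  -- The first term uses half of the available -σ‖δ‖²; the second is exactly the drop of the
  -- projection term of `lyapunov`, because 1 - (1 - τ)² = τ(2 - τ).
  have hyoung : 2 * (‖δ‖ * π) ≤ σ / 2 * ‖δ‖ ^ 2 + 2 / σ * π ^ 2 := by
    have : 0 ≤ (σ * ‖δ‖ - 2 * π) ^ 2 / (2 * σ) := by positivity
    have e : (σ * ‖δ‖ - 2 * π) ^ 2 / (2 * σ) =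
        σ / 2 * ‖δ‖ ^ 2 + 2 / σ * π ^ 2 - 2 * (‖δ‖ * π) := by
      field_simp; ring
    linarith
  have e1 : (‖y l - y'‖ ^ 2 + 2 * (τ * σ * (inner ℝ r (y l) - inner ℝ r y')) +
      (τ * σ) ^ 2 * ‖r‖ ^ 2) / (τ * σ) =
      ‖y l - y'‖ ^ 2 / (τ * σ) + 2 * (inner ℝ r (y l) - inner ℝ r y') + τ * σ * ‖r‖ ^ 2 := by
    field_simp
  have e2 : 2 / (σ * τ * (2 - τ)) * ((1 - τ) ^ 2 * π ^ 2) =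
      2 / (σ * τ * (2 - τ)) * π ^ 2 - 2 / σ * π ^ 2 := by
    have : (2 - τ) ≠ 0 := h2.ne'
    field_simp; ring
  rw [e1, e2]
  linarith

/-- The alternating direction method converges to a saddle point, if there is one, for all step
lengths `τ ∈ (0, 2)`. -/
theorem tendsto (h : IsSplitting D R g b σ τ p s y) (hσ : 0 < σ)
    (hτ : τ ∈ Set.Ioo (0 : ℝ) 2) (hD : IsClosed D)
    (hex : ∃ p' s' y', IsSaddle D R g b p' s' y') :
    ∃ p' s' y', IsSaddle D R g b p' s' y' ∧ Tendsto (fun l => p (l + 1)) atTop (𝓝 p') ∧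
      Tendsto s atTop (𝓝 s') ∧ Tendsto y atTop (𝓝 y') := by
  have h0 := hτ.1
  have h2 : 0 < 2 - τ := by linarith [hτ.2]
  have hanti : ∀ {p' s' y' : Y}, IsSaddle D R g b p' s' y' →
      Antitone fun l => lyapunov R σ τ s' y' (s l) (y l) := fun h' =>
    antitone_nat_of_succ_le fun l => by
      have := h.descent hσ hτ h' l
      have e1 : 0 ≤ (2 - τ) * σ * ‖p (l + 1) - s (l + 1) - b‖ ^ 2 := by positivity
      have e2 : 0 ≤ σ / 2 * ‖s (l + 1) - s l‖ ^ 2 := by positivity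
      linarith
  have hlim : ∀ {p' s' y' : Y}, IsSaddle D R g b p' s' y' →
      ∃ L, Tendsto (fun l => lyapunov R σ τ s' y' (s l) (y l)) atTop (𝓝 L) := fun h' =>
    ⟨_, tendsto_atTop_ciInf (hanti h')
      ⟨0, by rintro _ ⟨l, rfl⟩; exact lyapunov_nonneg R hσ hτ _ _ _ _⟩⟩
  have hsq : ∀ {w : ℕ → Y}, Tendsto (fun l => ‖w l‖ ^ 2) atTop (𝓝 0) → Tendsto w atTop (𝓝 0) := by
    intro w hw
    rw [tendsto_zero_iff_norm_tendsto_zero]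
    simpa using hw.sqrt
  obtain ⟨p₀, s₀, y₀, hs₀⟩ := hex
  obtain ⟨L, hL⟩ := hlim hs₀
  -- By `descent`, these differences dominate multiples of the squared residual and the squared
  -- increment of s.
  have hdiff : Tendsto (fun l => lyapunov R σ τ s₀ y₀ (s l) (y l) -
      lyapunov R σ τ s₀ y₀ (s (l + 1)) (y (l + 1))) atTop (𝓝 0) := by
    simpa using hL.sub ((tendsto_add_atTop_iff_nat 1).2 hL)
  have hr : Tendsto (fun l => p (l + 1) - s (l + 1) - b) atTop (𝓝 0) := by
    apply hsq
    have hd := hdiff.const_mul ((2 - τ) * σ)⁻¹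
    rw [mul_zero] at hd
    refine squeeze_zero (fun _ => by positivity) (fun l => ?_) hd
    rw [inv_mul_eq_div, le_div_iff₀' (by positivity)]
    have := h.descent hσ hτ hs₀ l
    have e2 : 0 ≤ σ / 2 * ‖s (l + 1) - s l‖ ^ 2 := by positivity
    linarith
  have hδ : Tendsto (fun l => s (l + 1) - s l) atTop (𝓝 0) := by
    apply hsq
    have hd := hdiff.const_mul (σ / 2)⁻¹
    rw [mul_zero] at hd
    refine squeeze_zero (fun _ => by positivity) (fun l => ?_) hd
    rw [inv_mul_eq_div, le_div_iff₀' (by positivity)]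
    have := h.descent hσ hτ hs₀ l
    have e1 : 0 ≤ (2 - τ) * σ * ‖p (l + 1) - s (l + 1) - b‖ ^ 2 := by positivity
    linarith
  have hproj : Tendsto (fun l => R.starProjection (y l)) atTop (𝓝 0) := by
    have e : ∀ l, R.starProjection (y l) = (1 - τ) ^ l • R.starProjection (y 0) := by
      intro l
      induction l with
      | zero => simp
      | succ l ih => rw [h.starProjection_succ, ih, smul_smul, pow_succ']
    rw [tendsto_congr e]
    have : Tendsto (fun l : ℕ => (1 - τ) ^ l) atTop (𝓝 0) :=
      tendsto_pow_atTop_nhds_zero_of_abs_lt_one (by rw [abs_lt]; constructor <;> linarith [hτ.2])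
    simpa using this.smul_const (R.starProjection (y 0))
  have hbdd : Bornology.IsBounded (Set.range fun l => (s l, y l)) := by
    have hle : ∀ l, lyapunov R σ τ s₀ y₀ (s l) (y l) ≤ lyapunov R σ τ s₀ y₀ (s 0) (y 0) :=
      fun l => hanti hs₀ (Nat.zero_le l)
    set C := lyapunov R σ τ s₀ y₀ (s 0) (y 0)
    refine ((Metric.isBounded_closedBall (x := s₀) (r := √(σ⁻¹ * C))).prod
      (Metric.isBounded_closedBall (x := y₀) (r := √(τ * σ * C)))).subset ?_
    rintro _ ⟨l, rfl⟩
    have hb := norm_sq_le_lyapunov R hσ hτ s₀ y₀ (s l) (y l)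
    refine ⟨?_, ?_⟩
    · rw [mem_closedBall_iff_norm]
      exact Real.le_sqrt_of_sq_le (hb.2.trans (by gcongr; exact hle l))
    · rw [mem_closedBall_iff_norm]
      exact Real.le_sqrt_of_sq_le (hb.1.trans (by gcongr; exact hle l))
  obtain ⟨⟨s', y'⟩, -, ψ, hψ, hsub⟩ :=
    tendsto_subseq_of_bounded hbdd (fun l => Set.mem_range_self l)
  have hsψ : Tendsto (fun n => s (ψ n)) atTop (𝓝 s') :=
    (continuous_fst.tendsto _).comp hsub
  have hyψ : Tendsto (fun n => y (ψ n)) atTop (𝓝 y') :=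
    (continuous_snd.tendsto _).comp hsub
  have hδψ := hδ.comp hψ.tendsto_atTop
  have hrψ := hr.comp hψ.tendsto_atTop
  have hpψ : Tendsto (fun n => p (ψ n + 1)) atTop (𝓝 (s' + b)) := by
    have := (hrψ.add (hδψ.add hsψ)).add_const b
    simp only [zero_add] at this
    refine this.congr fun n => ?_
    simp only [Function.comp]
    abel
  -- The cluster point inherits the variational inequality, whose penalty term vanishes in the
  -- limit; y' lies in Rᗮ because the projections of y decay.
  have hsad : IsSaddle D R g b (s' + b) s' y' := by
    refine ⟨hD.mem_of_tendsto hpψ (Eventually.of_forall fun n => h.mem _),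
      (Submodule.closed_of_finiteDimensional R).mem_of_tendsto hsψ
        (Eventually.of_forall fun n => h.mem_range _), rfl, ?_, fun x hx => ?_⟩
    · rw [← Submodule.starProjection_apply_eq_zero_iff]
      exact tendsto_nhds_unique ((R.starProjection.continuous.tendsto _).comp hyψ)
        (hproj.comp hψ.tendsto_atTop)
    · have hv : Tendsto (fun n => inner ℝ (x - p (ψ n + 1))
          (g + y (ψ n) + σ • (p (ψ n + 1) - s (ψ n) - b))) atTop
          (𝓝 (inner ℝ (x - (s' + b)) (g + y' + σ • (s' + b - s' - b)))) :=
        (hpψ.const_sub x).inner ((hyψ.const_add g).add (((hpψ.sub hsψ).sub_const b).const_smul σ))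
      rw [add_sub_cancel_left, sub_self, smul_zero, add_zero] at hv
      exact ge_of_tendsto' hv fun n => h.opt _ x hx
  obtain ⟨L', hL'⟩ := hlim hsad
  -- The Lyapunov function centred at the cluster point converges along the whole sequence, and
  -- along ψ all its terms tend to 0.
  have hzero : L' = 0 := by
    refine tendsto_nhds_unique (hL'.comp hψ.tendsto_atTop) ?_
    have e1 := (((hyψ.sub_const y').norm.pow 2).div_const (τ * σ)).add
      (((hsψ.sub_const s').norm.pow 2).const_mul σ)
    have e2 := e1.add (((hproj.comp hψ.tendsto_atTop).norm.pow 2).const_mul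
      (2 / (σ * τ * (2 - τ))))
    simpa [lyapunov, Function.comp_def] using e2
  rw [hzero] at hL'
  have hs : Tendsto s atTop (𝓝 s') := by
    rw [← tendsto_sub_nhds_zero_iff]
    refine hsq (squeeze_zero (fun _ => by positivity)
      (fun l => (norm_sq_le_lyapunov R hσ hτ s' y' (s l) (y l)).2) ?_)
    simpa using hL'.const_mul σ⁻¹
  have hy : Tendsto y atTop (𝓝 y') := by
    rw [← tendsto_sub_nhds_zero_iff]
    refine hsq (squeeze_zero (fun _ => by positivity)
      (fun l => (norm_sq_le_lyapunov R hσ hτ s' y' (s l) (y l)).1) ?_)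
    simpa using hL'.const_mul (τ * σ)
  refine ⟨s' + b, s', y', hsad, ?_, hs, hy⟩
  have := (hr.add ((tendsto_add_atTop_iff_nat 1).2 hs)).add_const b
  simp only [zero_add] at this
  exact this.congr fun n => by abel

end IsSplitting

/-- A quadratic function on a closed convex set has a minimizer, and the minimizers are
characterized by the variational inequality. -/
lemma exists_variational {D : Set Y} (hD : IsClosed D) (hconv : Convex ℝ D) (hne : D.Nonempty)
    {σ : ℝ} (hσ : 0 < σ) (g w : Y) :
    ∃ p ∈ D, ∀ x ∈ D, 0 ≤ inner ℝ (x - p) (g + σ • (p - w)) := by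
  -- Completing the square: the minimizer is the metric projection of w - σ⁻¹g to D.
  obtain ⟨p, hp, hmin⟩ := exists_norm_eq_iInf_of_complete_convex hne hD.isComplete hconv
    (w - σ⁻¹ • g)
  refine ⟨p, hp, fun x hx => ?_⟩
  have := (norm_eq_iInf_iff_real_inner_le_zero hconv hp).1 hmin x hx
  have e : g + σ • (p - w) = (-σ) • (w - σ⁻¹ • g - p) := by
    rw [← smul_inv_smul₀ hσ.ne' g, inv_smul_smul₀ hσ.ne']; module
  rw [e, inner_smul_right, real_inner_comm]
  nlinarith

lemma isMinOn_quad_iff {D : Set Y} (hD : IsClosed D) (hconv : Convex ℝ D)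
    {σ : ℝ} (hσ : 0 < σ) (g w : Y) {p : Y} (hp : p ∈ D) :
    (∀ x ∈ D, quad σ g w p ≤ quad σ g w x) ↔
      ∀ x ∈ D, 0 ≤ inner ℝ (x - p) (g + σ • (p - w)) := by
  constructor
  · intro h
    -- Comparison with a point p₀ that already solves the variational inequality: the quadratic
    -- remainder forces p = p₀.
    obtain ⟨p₀, hp₀, h₀⟩ := exists_variational hD hconv ⟨p, hp⟩ hσ g w
    have h1 := h p₀ hp₀
    rw [quad_eq σ g w p p₀] at h1
    have h2 := h₀ p hp
    have h3 : ‖p - p₀‖ ^ 2 ≤ 0 := by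
      by_contra hc
      have : 0 < σ / 2 * ‖p - p₀‖ ^ 2 := by push Not at hc; positivity
      linarith
    have h4 : p = p₀ := by
      rw [← sub_eq_zero, ← norm_eq_zero]
      exact pow_eq_zero_iff two_ne_zero |>.1 (le_antisymm h3 (by positivity))
    rwa [h4]
  · intro h x hx
    rw [quad_eq σ g w x p]
    have := h x hx
    have : 0 ≤ σ / 2 * ‖x - p‖ ^ 2 := by positivity
    linarith

end Splitting

end SurfaceDOT

namespace SurfaceDOT

/-! ### Linear algebra -/

/-- A vector orthogonal to the kernel of a matrix is in the range of the transpose. -/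
lemma exists_transpose_mulVec_eq {m n : Type*} [Fintype m] [Fintype n] [DecidableEq m]
    [DecidableEq n] (A : Matrix m n ℝ) (g : n → ℝ) (h : ∀ x, A *ᵥ x = 0 → g ⬝ᵥ x = 0) :
    ∃ w, Aᵀ *ᵥ w = g := by
  have hg : dotProductEquiv ℝ n g ∈ LinearMap.range A.mulVecLin.dualMap := by
    rw [LinearMap.range_dualMap_eq_dualAnnihilator_ker, Submodule.mem_dualAnnihilator]
    intro x hx
    exact h x hx
  obtain ⟨ψ, hψ⟩ := hg
  refine ⟨(dotProductEquiv ℝ m).symm ψ, ?_⟩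
  apply (dotProductEquiv ℝ n).injective
  rw [← hψ]
  ext x
  have e : ∀ y, ψ y = (dotProductEquiv ℝ m).symm ψ ⬝ᵥ y := fun y => by
    conv_lhs => rw [← (dotProductEquiv ℝ m).apply_symm_apply ψ]
    rfl
  simp only [LinearMap.comp_apply, dotProductEquiv_apply_apply, LinearMap.dualMap_apply,
    Matrix.mulVecLin_apply]
  rw [e, Matrix.mulVec_transpose, Matrix.dotProduct_mulVec]

/-- The range of a matrix is the image of the range of its transpose. -/
lemma exists_mulVec_transpose_eq {m n : Type*} [Fintype m] [Fintype n] [DecidableEq m]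
    [DecidableEq n] (A : Matrix m n ℝ) (x : n → ℝ) :
    ∃ w, A *ᵥ (Aᵀ *ᵥ w) = A *ᵥ x := by
  -- A Aᵀ y = 0 gives ‖Aᵀy‖² = 0, so A x is orthogonal to the kernel of the symmetric matrix A Aᵀ.
  obtain ⟨w, hw⟩ := exists_transpose_mulVec_eq (A * Aᵀ) (A *ᵥ x) (fun y hy => by
    have h0 : Aᵀ *ᵥ y = 0 := by
      rw [← dotProduct_self_eq_zero, Matrix.dotProduct_mulVec, Matrix.vecMul_transpose,
        Matrix.mulVec_mulVec, hy, zero_dotProduct]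
    rw [dotProduct_comm, Matrix.dotProduct_mulVec, ← Matrix.mulVec_transpose, h0,
      zero_dotProduct])
  refine ⟨w, ?_⟩
  rwa [Matrix.transpose_mul, Matrix.transpose_transpose, ← Matrix.mulVec_mulVec] at hw

/-- On the range of its transpose, a matrix has a linear left inverse. -/
lemma exists_leftInverse_on_range_transpose {m n : Type*} [Fintype m] [Fintype n]
    (A : Matrix m n ℝ) :
    ∃ P : (m → ℝ) →ₗ[ℝ] (n → ℝ), ∀ w, P (A *ᵥ (Aᵀ *ᵥ w)) = Aᵀ *ᵥ w := by
  obtain ⟨P, hP⟩ := LinearMap.exists_leftInverse_of_injective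
    (A.mulVecLin.domRestrict (LinearMap.range Aᵀ.mulVecLin)) (by
      rw [LinearMap.ker_eq_bot']
      rintro ⟨_, w, rfl⟩ h
      have h' : A *ᵥ (Aᵀ *ᵥ w) = 0 := h
      ext1
      change Aᵀ *ᵥ w = 0
      rw [← dotProduct_self_eq_zero, Matrix.dotProduct_mulVec, Matrix.vecMul_transpose, h',
        zero_dotProduct])
  refine ⟨(Submodule.subtype _).comp P, fun w => ?_⟩
  have := LinearMap.congr_fun hP ⟨Aᵀ *ᵥ w, w, rfl⟩
  exact congrArg Subtype.val this

variable {V T : Type*} [Fintype V] [DecidableEq V] [Fintype T] [DecidableEq T]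

/-! ### Geometry of the mesh -/

namespace TriMesh

omit [Fintype V] [DecidableEq V] [Fintype T] [DecidableEq T] in
lemma jac_mulVec_injective (M : TriMesh V T) (f : T) : Function.Injective (M.jac f).mulVec := by
  have h := (affineIndependent_iff_linearIndependent_vsub ℝ _ (0 : Fin 3)).1 (M.nondegenerate f)
  have h' := h.comp (fun j : Fin 2 => (⟨j.succ, Fin.succ_ne_zero j⟩ : {x : Fin 3 // x ≠ 0}))
    (fun i j hij => Fin.succ_injective _ (congrArg Subtype.val hij))
  rw [Fintype.linearIndependent_iff] at h'
  change Function.Injective (M.jac f).mulVecLin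
  rw [← LinearMap.ker_eq_bot, LinearMap.ker_eq_bot']
  intro x hx
  funext j
  refine h' x ?_ j
  ext d
  have := congrFun hx d
  simpa [Matrix.mulVec, dotProduct, jac, mul_comm] using this

omit [Fintype V] [DecidableEq V] [Fintype T] [DecidableEq T] in
lemma det_pos (M : TriMesh V T) (f : T) : 0 < ((M.jac f)ᵀ * M.jac f).det := by
  have := (Matrix.PosDef.conjTranspose_mul_self (M.jac f) (M.jac_mulVec_injective f)).det_pos
  simpa using this

omit [Fintype V] [DecidableEq V] [Fintype T] [DecidableEq T] in
lemma area_pos (M : TriMesh V T) (f : T) : 0 < M.area f :=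
  div_pos (Real.sqrt_pos.2 (M.det_pos f)) two_pos

omit [Fintype V] [DecidableEq T] in
lemma vertexArea_pos (M : TriMesh V T) (v : V) : 0 < M.vertexArea v := by
  refine mul_pos (by norm_num) (Finset.sum_pos (fun f _ => M.area_pos f) ?_)
  obtain ⟨f, hf⟩ := M.covered v
  exact ⟨f, by simpa using hf⟩

-- Pairing the gradient with the two edge vectors recovers differences of vertex values, so it
-- vanishes only for functions constant on the triangle.
omit [Fintype V] [DecidableEq V] [Fintype T] [DecidableEq T] in
lemma transpose_jac_mulVec_gradHat (M : TriMesh V T) (f : T) (x : Fin 3 → ℝ) :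
    (M.jac f)ᵀ *ᵥ (M.gradHat f *ᵥ x) = ![x 1 - x 0, x 2 - x 0] := by
  unfold gradHat
  rw [Matrix.mulVec_mulVec, ← Matrix.mul_assoc, ← Matrix.mul_assoc,
    Matrix.mul_nonsing_inv _ (M.det_pos f).ne'.isUnit, Matrix.one_mul]
  ext i
  fin_cases i <;> simp [Matrix.mulVec, dotProduct, Fin.sum_univ_three] <;> ring

omit [Fintype V] [DecidableEq V] [Fintype T] [DecidableEq T] in
lemma gradHat_mulVec_const (M : TriMesh V T) (f : T) (c : ℝ) :
    M.gradHat f *ᵥ (fun _ => c) = 0 := by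
  unfold gradHat
  rw [← Matrix.mulVec_mulVec]
  have : (!![-1, 1, 0; -1, 0, 1] : Matrix (Fin 2) (Fin 3) ℝ) *ᵥ (fun _ => c) = 0 := by
    ext i
    fin_cases i <;> simp [Matrix.mulVec, dotProduct, Fin.sum_univ_three]
  rw [this, Matrix.mulVec_zero]

omit [Fintype T] [DecidableEq T] in
lemma spaceGrad_mulVec (M : TriMesh V T) (γ : V → ℝ) (p : T × Fin 3) :
    (M.spaceGrad *ᵥ γ) p = (M.gradHat p.1 *ᵥ fun i => γ (M.vert p.1 i)) p.2 := by
  simp only [Matrix.mulVec, dotProduct, spaceGrad, Matrix.of_apply, Finset.sum_mul,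
    Finset.sum_filter, ite_mul, zero_mul]
  rw [Finset.sum_comm]
  simp

omit [Fintype T] [DecidableEq T] in
lemma spaceGrad_mulVec_const (M : TriMesh V T) (c : ℝ) : M.spaceGrad *ᵥ (fun _ => c) = 0 := by
  funext p
  rw [spaceGrad_mulVec, M.gradHat_mulVec_const]
  rfl

-- A zero gradient makes γ constant on each triangle, and a path of edges carries the value from v
-- to w.
omit [Fintype T] [DecidableEq T] in
lemma eq_of_spaceGrad_eq_zero (M : TriMesh V T) {γ : V → ℝ} (h : M.spaceGrad *ᵥ γ = 0)
    (v w : V) : γ v = γ w := by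
  have h1 : ∀ f i, γ (M.vert f i) = γ (M.vert f 0) := by
    intro f
    have h2 : (M.gradHat f *ᵥ fun i => γ (M.vert f i)) = 0 := by
      funext d
      rw [← M.spaceGrad_mulVec γ (f, d), h]
      rfl
    have h3 := M.transpose_jac_mulVec_gradHat f fun i => γ (M.vert f i)
    rw [h2, Matrix.mulVec_zero] at h3
    have e0 := congrFun h3 0
    have e1 := congrFun h3 1
    simp only [Pi.zero_apply, Matrix.cons_val_zero, Matrix.cons_val_one] at e0 e1
    intro i
    fin_cases i
    · rfl
    · change γ (M.vert f 1) = γ (M.vert f 0)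
      linarith
    · change γ (M.vert f 2) = γ (M.vert f 0)
      linarith
  obtain ⟨walk⟩ := M.connected.preconnected v w
  induction walk with
  | nil => rfl
  | cons hadj _ ih =>
    rw [← ih]
    rw [SimpleGraph.fromRel_adj] at hadj
    rcases hadj.2 with ⟨f, i, j, rfl, rfl⟩ | ⟨f, i, j, rfl, rfl⟩ <;> rw [h1 f i, h1 f j]

/-- On a connected mesh, every function of mean zero is a discrete divergence. -/
lemma exists_divergence_eq (M : TriMesh V T) (g : V → ℝ) (hg : ∑ v, g v = 0) :
    ∃ m, ∀ γ : V → ℝ, m ⬝ᵥ (M.spaceGrad *ᵥ γ) = g ⬝ᵥ γ := by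
  -- Fredholm alternative: the kernel of the gradient consists of constants, so zero sum is the
  -- solvability condition.
  obtain ⟨m, hm⟩ := exists_transpose_mulVec_eq M.spaceGrad g (fun γ hγ => by
    obtain ⟨v₀⟩ := M.connected.nonempty
    have : γ = fun _ => γ v₀ := funext fun v => M.eq_of_spaceGrad_eq_zero hγ v v₀
    rw [this, dotProduct, ← Finset.sum_mul, hg, zero_mul])
  exact ⟨m, fun γ => by rw [← hm, Matrix.dotProduct_mulVec, Matrix.mulVec_transpose]⟩

/-! ### The operators and weights in coordinates -/

omit [Fintype T] [DecidableEq T] in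
lemma opA_mulVec_inl (M : TriMesh V T) (N : ℕ) (φ : PhiIdx V N → ℝ) (j : Fin N) (v : V) :
    (M.opA N *ᵥ φ) (Sum.inl (j, v)) = N * (φ (j.succ, v) - φ (j.castSucc, v)) := by
  have e : ∀ k w, M.opA N (Sum.inl (j, v)) (k, w) =
      N * ((if k = j.succ then 1 else 0) - (if k = j.castSucc then 1 else 0)) *
        (if v = w then 1 else 0) := fun k w => by
    rw [← Matrix.one_apply]; rfl
  simp only [Matrix.mulVec, dotProduct, Fintype.sum_prod_type, e]
  simp [mul_sub, sub_mul, Finset.sum_sub_distrib]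

omit [Fintype T] [DecidableEq T] in
lemma opA_mulVec_inr (M : TriMesh V T) (N : ℕ) (φ : PhiIdx V N → ℝ) (k : Fin (N + 1))
    (x : T × Fin 3) :
    (M.opA N *ᵥ φ) (Sum.inr (k, x)) = (M.spaceGrad *ᵥ fun v => φ (k, v)) x := by
  have e : ∀ k' w, M.opA N (Sum.inr (k, x)) (k', w) =
      (if k = k' then 1 else 0) * M.spaceGrad x w := fun k' w => by
    rw [← Matrix.one_apply]; rfl
  simp only [Matrix.mulVec, dotProduct, Fintype.sum_prod_type, e]
  simp

/-- The diagonal of `𝒲_q`. -/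
noncomputable def wq (M : TriMesh V T) (N : ℕ) : QIdx V T N → ℝ :=
  Sum.elim (fun p => 1 / (N : ℝ) * M.vertexArea p.2) (fun p => 1 / (N : ℝ) * M.area p.2.1)

/-- The diagonal of `𝒲_z`. -/
noncomputable def wz (M : TriMesh V T) (N : ℕ) : ZIdx V T N → ℝ :=
  Sum.elim (fun p => 1 / (N : ℝ) * M.vertexArea p.2)
    (Sum.elim (fun p => 1 / (N : ℝ) * M.area p.2.2.1) (fun p => 1 / (N : ℝ) * M.vertexArea p.2))

omit [Fintype V] [DecidableEq T] in
lemma wq_pos (M : TriMesh V T) {N : ℕ} (hN : 0 < N) (a : QIdx V T N) : 0 < M.wq N a := by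
  have : (0 : ℝ) < 1 / N := by positivity
  rcases a with p | p
  · exact mul_pos this (M.vertexArea_pos _)
  · exact mul_pos this (M.area_pos _)

omit [Fintype V] [DecidableEq T] in
lemma wz_pos (M : TriMesh V T) {N : ℕ} (hN : 0 < N) (a : ZIdx V T N) : 0 < M.wz N a := by
  have : (0 : ℝ) < 1 / N := by positivity
  rcases a with p | p | p
  · exact mul_pos this (M.vertexArea_pos _)
  · exact mul_pos this (M.area_pos _)
  · exact mul_pos this (M.vertexArea_pos _)

lemma Wq_mulVec (M : TriMesh V T) (N : ℕ) (x : QIdx V T N → ℝ) :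
    M.Wq N *ᵥ x = M.wq N * x := by
  have : M.Wq N = Matrix.diagonal (M.wq N) := by
    unfold Wq wq WstV WcT
    rw [← Matrix.diagonal_one, ← Matrix.diagonal_one, ← Matrix.diagonal_one,
      Matrix.diagonal_kronecker_diagonal, Matrix.diagonal_kronecker_diagonal,
      Matrix.diagonal_kronecker_diagonal, ← Matrix.diagonal_smul, ← Matrix.diagonal_smul,
      Matrix.fromBlocks_diagonal]
    congr 1
    funext a
    rcases a with p | p <;> simp
  rw [this]
  exact funext fun a => Matrix.mulVec_diagonal _ _ a

lemma Wz_mulVec (M : TriMesh V T) (N : ℕ) (x : ZIdx V T N → ℝ) :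
    M.Wz N *ᵥ x = M.wz N * x := by
  have : M.Wz N = Matrix.diagonal (M.wz N) := by
    unfold Wz wz WstV WstT
    ext a b
    rcases a with a | a | a <;> rcases b with b | b | b <;>
      simp [Matrix.diagonal_apply, Matrix.one_apply, Prod.ext_iff] <;> grind
  rw [this]
  exact funext fun a => Matrix.mulVec_diagonal _ _ a

omit [DecidableEq T] in
lemma WcV_mulVec_costVec_dotProduct (M : TriMesh V T) {N : ℕ} (hN : 0 < N) (μ₀ μ₁ : V → ℝ)
    (φ : PhiIdx V N → ℝ) :
    (M.WcV N *ᵥ costVec N μ₀ μ₁) ⬝ᵥ φ = ∑ v, M.vertexArea v * μ₀ v * φ (0, v) -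
      ∑ v, M.vertexArea v * μ₁ v * φ (Fin.last N, v) := by
  have hN' : (N : ℝ) ≠ 0 := by positivity
  have hW : M.WcV N = Matrix.diagonal fun p => 1 / (N : ℝ) * M.vertexArea p.2 := by
    unfold WcV
    rw [← Matrix.diagonal_one, Matrix.diagonal_kronecker_diagonal, ← Matrix.diagonal_smul]
    congr 1
    funext p
    simp
  rw [hW]
  simp only [dotProduct, Matrix.mulVec_diagonal, Fintype.sum_prod_type, costVec]
  have e : ∀ (k : Fin (N + 1)) v, 1 / (N : ℝ) * M.vertexArea v *
      (N * ((if k = 0 then μ₀ v else 0) - (if k = Fin.last N then μ₁ v else 0))) * φ (k, v) =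
      (if k = 0 then M.vertexArea v * μ₀ v * φ (0, v) else 0) -
      (if k = Fin.last N then M.vertexArea v * μ₁ v * φ (Fin.last N, v) else 0) := by
    intro k v
    split_ifs <;> (try subst_vars) <;> field_simp <;> simp_all
  simp only [e, Finset.sum_sub_distrib]
  rw [Finset.sum_comm, Finset.sum_comm (f := fun (k : Fin (N + 1)) v =>
    if k = Fin.last N then M.vertexArea v * μ₁ v * φ (Fin.last N, v) else 0)]
  simp

end TriMesh

end SurfaceDOT

namespace SurfaceDOT

/-! ### Second-order cones -/

section SOC

variable {ι : Type*} [Fintype ι]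

/-- The Cauchy-Schwarz inequality for finite sums, with square roots. -/
lemma abs_sum_mul_le_sqrt_mul_sqrt (x y : ι → ℝ) :
    |∑ i, x i * y i| ≤ √(∑ i, x i ^ 2) * √(∑ i, y i ^ 2) := by
  rw [← Real.sqrt_mul (Finset.sum_nonneg fun i _ => sq_nonneg _)]
  exact Real.abs_le_sqrt (Finset.sum_mul_sq_le_sq_mul_sq _ x y)

lemma dotProduct_nonneg_of_mem_soc {x y : Unit ⊕ ι → ℝ} (hx : x ∈ soc ι) (hy : y ∈ soc ι) :
    0 ≤ x ⬝ᵥ y := by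
  simp only [soc, Set.mem_ofPred_eq] at hx hy
  simp only [dotProduct, Fintype.sum_sum_type, Finset.univ_unique, Finset.sum_singleton]
  have h1 := abs_sum_mul_le_sqrt_mul_sqrt (fun i => x (Sum.inr i)) (fun i => y (Sum.inr i))
  have h2 := mul_le_mul hx hy (Real.sqrt_nonneg _) ((Real.sqrt_nonneg _).trans hx)
  have h3 := neg_abs_le (∑ i, x (Sum.inr i) * y (Sum.inr i))
  have : (default : Unit) = () := rfl
  rw [this]
  linarith

/-- The second-order cone is self-dual. -/
lemma mem_soc_of_forall_dotProduct_nonneg {x : Unit ⊕ ι → ℝ}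
    (h : ∀ y ∈ soc ι, 0 ≤ x ⬝ᵥ y) : x ∈ soc ι := by
  set n := √(∑ i, x (Sum.inr i) ^ 2) with hn
  have hn0 : 0 ≤ n := Real.sqrt_nonneg _
  have hn2 : n ^ 2 = ∑ i, x (Sum.inr i) ^ 2 :=
    Real.sq_sqrt (Finset.sum_nonneg fun i _ => sq_nonneg _)
  change n ≤ x (Sum.inl ())
  -- The boundary vector (‖x̄‖; -x̄) gives ‖x̄‖² ≤ ‖x̄‖ x₀; the axis vector (1; 0) below settles x̄
  -- = 0.
  have h1 := h (Sum.elim (fun _ => n) (fun i => -x (Sum.inr i))) (by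
    simp [soc, ← hn])
  have h2 := h (Sum.elim (fun _ => 1) (fun _ => 0)) (by simp [soc])
  simp only [dotProduct, Fintype.sum_sum_type, Finset.univ_unique, Finset.sum_singleton,
    Sum.elim_inl, Sum.elim_inr, mul_neg, Finset.sum_neg_distrib, ← sq, ← hn2, mul_one, mul_zero,
    Finset.sum_const_zero, add_zero] at h1 h2
  have e : (default : Unit) = () := rfl
  rw [e] at h1 h2
  rcases hn0.eq_or_lt with h0 | h0
  · rwa [← h0]
  · nlinarith

lemma isClosed_soc : IsClosed (soc ι) :=
  isClosed_le (by fun_prop) (by fun_prop)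

/-- In the form of a dual cone, closure under sums and nonnegative multiples is immediate. -/
lemma soc_eq_dual : soc ι = {x | ∀ y ∈ soc ι, 0 ≤ x ⬝ᵥ y} :=
  Set.ext fun _ => ⟨fun hx _ hy => dotProduct_nonneg_of_mem_soc hx hy,
    mem_soc_of_forall_dotProduct_nonneg⟩

lemma zero_mem_soc : (0 : Unit ⊕ ι → ℝ) ∈ soc ι := by simp [soc]

lemma add_mem_soc {x y : Unit ⊕ ι → ℝ} (hx : x ∈ soc ι) (hy : y ∈ soc ι) : x + y ∈ soc ι := by
  rw [soc_eq_dual] at hx hy ⊢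
  intro w hw
  rw [add_dotProduct]
  exact add_nonneg (hx w hw) (hy w hw)

lemma smul_mem_soc {x : Unit ⊕ ι → ℝ} (hx : x ∈ soc ι) {c : ℝ} (hc : 0 ≤ c) :
    c • x ∈ soc ι := by
  rw [soc_eq_dual] at hx ⊢
  intro w hw
  rw [smul_dotProduct]
  exact mul_nonneg hc (hx w hw)

end SOC

variable {V T : Type*} [DecidableEq V] [Fintype T]

namespace TriMesh

lemma isClosed_coneQ (M : TriMesh V T) (N : ℕ) : IsClosed (M.coneQ N) := by
  have : M.coneQ N = ⋂ p : StV V N, {u | (fun b => u ⟨p, b⟩) ∈ soc (M.Tail p.2)} := by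
    ext; simp [coneQ]
  rw [this]
  exact isClosed_iInter fun p => isClosed_soc.preimage (by fun_prop)

lemma zero_mem_coneQ (M : TriMesh V T) (N : ℕ) : (0 : M.TIdx N → ℝ) ∈ M.coneQ N :=
  fun _ => zero_mem_soc

lemma add_mem_coneQ (M : TriMesh V T) {N : ℕ} {x y : M.TIdx N → ℝ} (hx : x ∈ M.coneQ N)
    (hy : y ∈ M.coneQ N) : x + y ∈ M.coneQ N :=
  fun p => add_mem_soc (hx p) (hy p)

lemma smul_mem_coneQ (M : TriMesh V T) {N : ℕ} {x : M.TIdx N → ℝ} (hx : x ∈ M.coneQ N)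
    {c : ℝ} (hc : 0 ≤ c) : c • x ∈ M.coneQ N :=
  fun p => smul_mem_soc (hx p) hc

lemma convex_coneQ (M : TriMesh V T) (N : ℕ) : Convex ℝ (M.coneQ N) :=
  fun _ hx _ hy _ _ ha hb _ => M.add_mem_coneQ (M.smul_mem_coneQ hx ha) (M.smul_mem_coneQ hy hb)

variable [Fintype V]

lemma dotProduct_nonneg_of_mem_coneQ (M : TriMesh V T) {N : ℕ} {x y : M.TIdx N → ℝ}
    (hx : x ∈ M.coneQ N) (hy : y ∈ M.coneQ N) : 0 ≤ x ⬝ᵥ y := by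
  rw [dotProduct, Fintype.sum_sigma]
  exact Finset.sum_nonneg fun p _ => dotProduct_nonneg_of_mem_soc (hx p) (hy p)

/-- The product of second-order cones is self-dual. -/
lemma mem_coneQ_of_forall_dotProduct_nonneg (M : TriMesh V T) {N : ℕ} {x : M.TIdx N → ℝ}
    (h : ∀ y ∈ M.coneQ N, 0 ≤ x ⬝ᵥ y) : x ∈ M.coneQ N := by
  intro p
  refine mem_soc_of_forall_dotProduct_nonneg fun y hy => ?_
  -- Extension by zero to the other blocks reduces self-duality to a single block.
  let y' : (p' : StV V N) → (Unit ⊕ M.Tail p'.2) → ℝ := Pi.single p y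
  have := h (fun r => y' r.1 r.2) (fun p' => by
    change y' p' ∈ _
    by_cases hp : p' = p
    · subst hp; simpa [y'] using hy
    · simpa [y', hp] using zero_mem_soc)
  rw [dotProduct, Fintype.sum_sigma, Finset.sum_eq_single p] at this
  · simp only [y', Pi.single_eq_same] at this
    exact this
  · intro p' _ hp
    simp [y', hp]
  · simp

lemma mem_interior_coneQ (M : TriMesh V T) {N : ℕ} {x : M.TIdx N → ℝ}
    (h : ∀ p : StV V N, ∑ i, x ⟨p, Sum.inr i⟩ ^ 2 < x ⟨p, Sum.inl ()⟩ ^ 2 ∧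
      0 < x ⟨p, Sum.inl ()⟩) : x ∈ interior (M.coneQ N) := by
  refine interior_maximal (s := M.coneQ N) (t := ⋂ p : StV V N, {u : M.TIdx N → ℝ |
    √(∑ i, u ⟨p, Sum.inr i⟩ ^ 2) < u ⟨p, Sum.inl ()⟩}) ?_ ?_ ?_
  · intro u hu p
    have h1 : √(∑ i, u ⟨p, Sum.inr i⟩ ^ 2) < u ⟨p, Sum.inl ()⟩ := Set.mem_iInter.1 hu p
    exact h1.le
  · exact isOpen_iInter_of_finite fun p => isOpen_lt (by fun_prop) (by fun_prop)
  · refine Set.mem_iInter.2 fun p => ?_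
    exact (Real.sqrt_lt' (h p).2).2 (h p).1

/-! ### The operators `𝒯` and `ℬℱ` -/

variable [DecidableEq T]

/-- The entry of `z` selected by a row of `𝒯`. -/
def tEquiv (M : TriMesh V T) (N : ℕ) : M.TIdx N ≃ ZIdx V T N where
  toFun r := match r with
    | ⟨p, Sum.inl _⟩ => Sum.inl p
    | ⟨p, Sum.inr (Sum.inl (s, ⟨i, f⟩, d))⟩ => Sum.inr (Sum.inl ((s, i), (p.1, (f.1, d))))
    | ⟨p, Sum.inr (Sum.inr _)⟩ => Sum.inr (Sum.inr p)
  invFun a := match a with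
    | Sum.inl p => ⟨p, Sum.inl ()⟩
    | Sum.inr (Sum.inl ((s, i), (k, (f, d)))) =>
      ⟨(k, M.vert f i), Sum.inr (Sum.inl (s, ⟨i, ⟨f, rfl⟩⟩, d))⟩
    | Sum.inr (Sum.inr p) => ⟨p, Sum.inr (Sum.inr ())⟩
  left_inv := by
    rintro ⟨⟨k, v⟩, _ | ⟨s, ⟨i, ⟨f, hf⟩⟩, d⟩ | _⟩
    · rfl
    · dsimp at hf; subst hf; rfl
    · rfl
  right_inv := by
    rintro (p | ⟨⟨s, i⟩, k, f, d⟩ | p) <;> rfl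

/-- The nonzero entry of a row of `𝒯`. -/
noncomputable def tCoef (M : TriMesh V T) (N : ℕ) (r : M.TIdx N) : ℝ := match r with
  | ⟨_, Sum.inl _⟩ => 1
  | ⟨p, Sum.inr (Sum.inl (_, ⟨_, f⟩, _))⟩ => √(M.area f.1 / M.vertexArea p.2)
  | ⟨_, Sum.inr (Sum.inr _)⟩ => 1

omit [Fintype V] [DecidableEq T] in
lemma tCoef_pos (M : TriMesh V T) (N : ℕ) (r : M.TIdx N) : 0 < M.tCoef N r := by
  rcases r with ⟨⟨k, v⟩, _ | ⟨s, ⟨i, ⟨f, hf⟩⟩, d⟩ | _⟩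
  · exact one_pos
  · exact Real.sqrt_pos.2 (div_pos (M.area_pos _) (M.vertexArea_pos _))
  · exact one_pos

-- Each coordinate of z is selected by exactly one row, as the i-th copy on f belongs only to the
-- block of the i-th vertex of f. Up to the bijection `tEquiv`, 𝒯 is thus diagonal with positive
-- entries, hence invertible.
omit [Fintype V] in
lemma opT_apply (M : TriMesh V T) (N : ℕ) (r : M.TIdx N) :
    M.opT N r = Pi.single (M.tEquiv N r) (M.tCoef N r) := by
  rcases r with ⟨⟨k, v⟩, _ | ⟨s, ⟨i, ⟨f, hf⟩⟩, d⟩ | _⟩ <;> rfl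

lemma opT_mulVec (M : TriMesh V T) (N : ℕ) (z : ZIdx V T N → ℝ) (r : M.TIdx N) :
    (M.opT N *ᵥ z) r = M.tCoef N r * z (M.tEquiv N r) := by
  rw [Matrix.mulVec, opT_apply, single_dotProduct]

lemma opT_transpose_mulVec (M : TriMesh V T) (N : ℕ) (u : M.TIdx N → ℝ) (r : M.TIdx N) :
    ((M.opT N)ᵀ *ᵥ u) (M.tEquiv N r) = M.tCoef N r * u r := by
  simp only [Matrix.mulVec, dotProduct, Matrix.transpose_apply, opT_apply]
  rw [Finset.sum_eq_single r]
  · rw [Pi.single_eq_same]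
  · intro r' _ hr
    rw [Pi.single_eq_of_ne ((M.tEquiv N).injective.ne hr.symm), zero_mul]
  · simp

lemma opT_mulVec_surjective (M : TriMesh V T) (N : ℕ) (u : M.TIdx N → ℝ) :
    ∃ z, M.opT N *ᵥ z = u :=
  ⟨fun a => u ((M.tEquiv N).symm a) / M.tCoef N ((M.tEquiv N).symm a), funext fun r => by
    rw [opT_mulVec, Equiv.symm_apply_apply, mul_div_cancel₀ _ (M.tCoef_pos N r).ne']⟩

lemma opT_transpose_mulVec_div (M : TriMesh V T) (N : ℕ) (w : ZIdx V T N → ℝ) :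
    (M.opT N)ᵀ *ᵥ (fun r => w (M.tEquiv N r) / M.tCoef N r) = w := funext fun a => by
  obtain ⟨r, rfl⟩ := (M.tEquiv N).surjective a
  rw [opT_transpose_mulVec, mul_div_cancel₀ _ (M.tCoef_pos N r).ne']

/-- `𝒯*ℚ` is the dual cone of `{z | 𝒯 z ∈ ℚ}`. -/
lemma mem_image_coneQ_iff (M : TriMesh V T) (N : ℕ) (w : ZIdx V T N → ℝ) :
    w ∈ (fun u => (M.opT N)ᵀ *ᵥ u) '' M.coneQ N ↔
      ∀ z, M.opT N *ᵥ z ∈ M.coneQ N → 0 ≤ w ⬝ᵥ z := by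
  constructor
  · rintro ⟨u, hu, rfl⟩ z hz
    dsimp only
    rw [Matrix.mulVec_transpose, ← Matrix.dotProduct_mulVec]
    exact M.dotProduct_nonneg_of_mem_coneQ hu hz
  · intro h
    refine ⟨_, M.mem_coneQ_of_forall_dotProduct_nonneg fun y hy => ?_,
      M.opT_transpose_mulVec_div N w⟩
    obtain ⟨z, rfl⟩ := M.opT_mulVec_surjective N y
    rw [Matrix.dotProduct_mulVec, ← Matrix.mulVec_transpose, M.opT_transpose_mulVec_div]
    exact h z hy

end TriMesh

/-- The operator `ℬℱ` as a linear map. -/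
noncomputable def opBF (V T : Type*) [Fintype V] [DecidableEq V] [Fintype T] [DecidableEq T] (N : ℕ) :
    (QIdx V T N → ℝ) →ₗ[ℝ] (ZIdx V T N → ℝ) :=
  (opB V T N).mulVecLin.comp (opF V T N).mulVecLin

variable [Fintype V] [DecidableEq T]

lemma opFtilde_mulVec (T : Type*) [Fintype T] [DecidableEq T] (N : ℕ) (m : CT T N → ℝ)
    (s : Fin 2) (i : Fin 3) (j : Fin N) (x : T × Fin 3) :
    (opFtilde T N *ᵥ m) ((s, i), (j, x)) = m (if s = 0 then j.castSucc else j.succ, x) := by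
  have e : ∀ k y, opFtilde T N ((s, i), (j, x)) (k, y) =
      (if k = (if s = 0 then j.castSucc else j.succ) then 1 else 0) *
        (if x = y then 1 else 0) := fun k y => by
    rw [← Matrix.one_apply (i := x)]
    change (if s = 0 then copyPlus N else copyMinus N) j k * _ = _
    by_cases hs : s = 0 <;> simp [copyPlus, copyMinus, hs]
  rw [Matrix.mulVec, dotProduct, Fintype.sum_prod_type]
  simp only [e]
  simp

lemma opBF_inl (N : ℕ) (q : QIdx V T N → ℝ) (p : StV V N) :
    opBF V T N q (Sum.inl p) = -q (Sum.inl p) := by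
  rw [opBF, LinearMap.comp_apply, Matrix.mulVecLin_apply, Matrix.mulVecLin_apply, opB, opF,
    Matrix.fromBlocks_mulVec, Matrix.fromRows_mulVec, Sum.elim_inl, Matrix.fromCols_mulVec]
  simp [Matrix.neg_mulVec]

lemma opBF_inr_inr (N : ℕ) (q : QIdx V T N → ℝ) (p : StV V N) :
    opBF V T N q (Sum.inr (Sum.inr p)) = q (Sum.inl p) := by
  rw [opBF, LinearMap.comp_apply, Matrix.mulVecLin_apply, Matrix.mulVecLin_apply, opB, opF,
    Matrix.fromBlocks_mulVec, Matrix.fromRows_mulVec, Sum.elim_inr, Matrix.fromRows_mulVec,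
    Sum.elim_inr, Matrix.fromCols_mulVec]
  simp

lemma opBF_inr_inl (N : ℕ) (q : QIdx V T N → ℝ) (a : SixIdx T N) :
    opBF V T N q (Sum.inr (Sum.inl a)) =
      √3 / 3 * (opFtilde T N *ᵥ fun b => q (Sum.inr b)) a := by
  rw [opBF, LinearMap.comp_apply, Matrix.mulVecLin_apply, Matrix.mulVecLin_apply, opB, opF,
    Matrix.fromBlocks_mulVec, Matrix.fromRows_mulVec, Sum.elim_inr, Matrix.fromRows_mulVec,
    Sum.elim_inl, Matrix.fromCols_mulVec]
  simp [Matrix.smul_mulVec, Function.comp_def]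

/-- Every centered time has a staggered neighbour: time 0 is seen by a + copy, which needs N > 0,
and the later times by - copies. Injectivity makes the transpose surjective, as the dual Slater
point requires. -/
lemma opFtilde_mulVec_eq_zero {N : ℕ} (hN : 0 < N) {m : CT T N → ℝ}
    (h : opFtilde T N *ᵥ m = 0) : m = 0 := by
  funext ⟨k, x⟩
  rcases Fin.eq_zero_or_eq_succ k with rfl | ⟨j, rfl⟩
  · have := congrFun h ((0, 0), (⟨0, hN⟩, x))
    rw [opFtilde_mulVec] at this
    exact this
  · have := congrFun h ((1, 0), (j, x))
    rw [opFtilde_mulVec] at this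
    exact this

end SurfaceDOT

namespace SurfaceDOT

/-! ### Conic duality -/

section Duality

variable {Φ U : Type*} [AddCommGroup Φ] [Module ℝ Φ] [NormedAddCommGroup U] [NormedSpace ℝ U]

/-- If a functional is coercive on the cone, then the conic program has a minimizer. -/
lemma exists_conic_minimizer [FiniteDimensional ℝ U] (L : Φ →ₗ[ℝ] U) (d : U) {K : Set U}
    (hK : IsClosed K) (u : U →ₗ[ℝ] ℝ) {ε : ℝ} (hε : 0 < ε) (hu : ∀ y ∈ K, ε * ‖y‖ ≤ u y)
    {φ₀ : Φ} (h₀ : L φ₀ + d ∈ K) :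
    ∃ φ', L φ' + d ∈ K ∧ ∀ φ, L φ + d ∈ K → u (L φ') ≤ u (L φ) := by
  have hcont : Continuous u := u.continuous_of_finiteDimensional
  have : ProperSpace U := FiniteDimensional.proper ℝ U
  have hA : IsClosed ((fun y => y - d) ⁻¹' (LinearMap.range L : Set U)) :=
    (Submodule.closed_of_finiteDimensional _).preimage (by fun_prop)
  have hmem : ∀ φ, L φ + d ∈ (fun y => y - d) ⁻¹' (LinearMap.range L : Set U) :=
    fun φ => ⟨φ, by simp⟩
  have hball : ∀ y ∈ K, u y ≤ u (L φ₀ + d) → y ∈ Metric.closedBall 0 (u (L φ₀ + d) / ε) := by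
    intro y hy hle
    rw [mem_closedBall_zero_iff, le_div_iff₀' hε]
    exact (hu y hy).trans hle
  -- Compactness is used for the images L φ + d, not for φ itself, because L may have a kernel.
  obtain ⟨y, ⟨⟨hyK, φ', hφ'⟩, -⟩, hmin⟩ := ((isCompact_closedBall (0 : U)
    (u (L φ₀ + d) / ε)).inter_left (hK.inter hA)).exists_isMinOn
    ⟨L φ₀ + d, ⟨h₀, hmem φ₀⟩, hball _ h₀ le_rfl⟩ hcont.continuousOn
  have hy : L φ' + d = y := by rw [hφ']; simp
  subst hy
  refine ⟨φ', hyK, fun φ hφ => ?_⟩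
  have h1 : u (L φ' + d) ≤ u (L φ + d) := by
    by_cases hle : u (L φ + d) ≤ u (L φ₀ + d)
    · exact hmin ⟨⟨hφ, hmem φ⟩, hball _ hφ hle⟩
    · exact (hmin ⟨⟨h₀, hmem φ₀⟩, hball _ h₀ le_rfl⟩).trans (not_le.1 hle).le
  simpa using h1

open scoped Pointwise in
/-- Under Slater's condition a minimizer of a conic program has a Lagrange multiplier. -/
lemma exists_conic_multiplier (ℓ : Φ →ₗ[ℝ] ℝ) (L : Φ →ₗ[ℝ] U) (d : U) {K : Set U}
    (hconv : Convex ℝ K) (hcone : ∀ y ∈ K, ∀ c : ℝ, 0 ≤ c → c • y ∈ K)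
    {φ₀ φ' : Φ} (hslater : L φ₀ + d ∈ interior K) (hmem : L φ' + d ∈ K)
    (hmin : ∀ φ, L φ + d ∈ K → ℓ φ' ≤ ℓ φ) :
    ∃ u : U →L[ℝ] ℝ, (∀ y ∈ K, 0 ≤ u y) ∧ u (L φ' + d) = 0 ∧ ∀ φ, ℓ φ = u (L φ) := by
  -- Optimality of φ' says that 0 is not in A + B: otherwise some feasible φ would have smaller
  -- cost. The interior in B makes the sum open, ready for separation.
  let A : Set (ℝ × U) := Set.range fun φ => (ℓ φ - ℓ φ', L φ + d)
  let B : Set (ℝ × U) := Set.Ioi 0 ×ˢ (-interior K)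
  have hA : Convex ℝ A := by
    rintro _ ⟨φ₁, rfl⟩ _ ⟨φ₂, rfl⟩ a b _ _ hab
    refine ⟨a • φ₁ + b • φ₂, Prod.ext ?_ ?_⟩
    · simp only [map_add, map_smul, Prod.smul_mk, Prod.mk_add_mk, smul_eq_mul]
      linear_combination (-ℓ φ') * hab.symm
    · simp only [map_add, map_smul, Prod.smul_mk, Prod.mk_add_mk]
      calc a • L φ₁ + b • L φ₂ + d = a • L φ₁ + b • L φ₂ + (a + b) • d := by rw [hab, one_smul]
        _ = _ := by module
  have hB : Convex ℝ B := (convex_Ioi 0).prod hconv.interior.neg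
  have hBo : IsOpen B := isOpen_Ioi.prod isOpen_interior.neg
  have h0 : (0 : ℝ × U) ∉ A + B := by
    rintro ⟨_, ⟨φ, rfl⟩, ⟨s, y⟩, ⟨hs, hy⟩, h⟩
    have h1 : ℓ φ - ℓ φ' + s = 0 := congrArg Prod.fst h
    have h2 : L φ + d + y = 0 := congrArg Prod.snd h
    have h3 : L φ + d ∈ K := by
      rw [eq_neg_of_add_eq_zero_left h2]
      exact interior_subset hy
    have := hmin φ h3
    have hs' : (0 : ℝ) < s := hs
    linarith
  obtain ⟨f, hf⟩ := geometric_hahn_banach_open_point (hA.add hB) hBo.add_left h0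
  rw [map_zero] at hf
  set c : ℝ := f (1, 0)
  have hsplit : ∀ (t : ℝ) (y : U), f (t, y) = t * c + f (0, y) := by
    intro t y
    have : ((t, y) : ℝ × U) = t • (1, 0) + (0, y) := by simp
    rw [this, map_add, map_smul, smul_eq_mul]
  set v : U →L[ℝ] ℝ := f.comp (ContinuousLinearMap.inr ℝ ℝ U)
  have hv : ∀ y, f (0, y) = v y := fun y => rfl
  have hlt : ∀ φ s, 0 < s → ∀ y ∈ interior K, (ℓ φ - ℓ φ' + s) * c + v (L φ + d) < v y := by
    intro φ s hs y hy
    have := hf _ (Set.add_mem_add ⟨φ, rfl⟩ (show (s, -y) ∈ B from ⟨hs, by simpa using hy⟩))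
    rw [Prod.mk_add_mk, hsplit, hv, map_add, map_neg] at this
    linarith
  have hle : ∀ φ s, 0 ≤ s → ∀ y ∈ K, (ℓ φ - ℓ φ' + s) * c + v (L φ + d) ≤ v y := by
    have hle1 : ∀ φ s, 0 < s → ∀ y ∈ K, (ℓ φ - ℓ φ' + s) * c + v (L φ + d) ≤ v y := by
      intro φ s hs y hy
      have hy' : y ∈ closure (interior K) := by
        rw [hconv.closure_interior_eq_closure_of_nonempty_interior ⟨_, hslater⟩]
        exact subset_closure hy
      exact closure_minimal (fun y hy => (hlt φ s hs y hy).le)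
        (isClosed_le continuous_const v.continuous) hy'
    intro φ s hs y hy
    have ht : Tendsto (fun s : ℝ => (ℓ φ - ℓ φ' + s) * c + v (L φ + d)) (𝓝[>] s)
        (𝓝 ((ℓ φ - ℓ φ' + s) * c + v (L φ + d))) :=
      (Continuous.tendsto (by fun_prop) s).mono_left nhdsWithin_le_nhds
    refine le_of_tendsto ht ?_
    filter_upwards [self_mem_nhdsWithin] with s' hs'
    exact hle1 φ s' (hs.trans_lt hs') y hy
  -- The separating functional is not vertical: at the Slater point the two values of v cancel,
  -- leaving a positive multiple of c below 0.
  have hc : c < 0 := by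
    have h1 := hlt φ₀ (|ℓ φ₀ - ℓ φ'| + 1) (by positivity) _ hslater
    have h2 : 0 < ℓ φ₀ - ℓ φ' + (|ℓ φ₀ - ℓ φ'| + 1) := by
      linarith [neg_abs_le (ℓ φ₀ - ℓ φ')]
    by_contra hcon
    push Not at hcon
    have := mul_nonneg h2.le hcon
    linarith
  have hvK : ∀ y ∈ K, 0 ≤ v y := by
    intro y hy
    by_contra hneg
    push Not at hneg
    have h1 := hle φ' 0 le_rfl
    simp only [sub_self, add_zero, zero_mul, zero_add] at h1
    set C := v (L φ' + d)
    have hC := h1 0 (by simpa using hcone y hy 0 le_rfl)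
    rw [map_zero] at hC
    -- The multiple of y is chosen so that v takes the value C - 1, below the lower bound C of v on
    -- K.
    have h2 := h1 (((C - 1) / v y) • y) (hcone y hy _ (div_nonneg_of_nonpos (by linarith) hneg.le))
    rw [map_smul, smul_eq_mul, div_mul_cancel₀ _ hneg.ne] at h2
    linarith
  have hcompl : v (L φ' + d) = 0 := by
    refine le_antisymm ?_ (hvK _ hmem)
    have h1 := hle φ' 0 le_rfl 0 (by simpa using hcone _ hmem 0 le_rfl)
    simpa using h1
  -- Translation by φ' makes the inequality linear in φ; applied to φ and -φ it becomes an equality.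
  have hlin : ∀ φ, ℓ φ * c + v (L φ) ≤ 0 := by
    intro φ
    have h1 := hle (φ + φ') 0 le_rfl 0 (by simpa using hcone _ hmem 0 le_rfl)
    have e : L (φ + φ') + d = L φ + (L φ' + d) := by rw [map_add, add_assoc]
    rw [e, map_add ℓ, map_add v, hcompl, map_zero] at h1
    simpa using h1
  refine ⟨(-c)⁻¹ • v, fun y hy => ?_, ?_, fun φ => ?_⟩
  · exact mul_nonneg (inv_nonneg.2 (by linarith)) (hvK y hy)
  · rw [_root_.smul_apply, hcompl, smul_zero]
  · have h1 := hlin φ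
    have h2 := hlin (-φ)
    rw [map_neg, map_neg, map_neg] at h2
    rw [_root_.smul_apply, smul_eq_mul, inv_mul_eq_div,
      eq_div_iff (by linarith)]
    linarith

/-- A functional in the interior of the dual cone is coercive on the cone. -/
lemma exists_coercive_of_mem_interior {κ : Type*} [Fintype κ] [DecidableEq κ] {K : Set (κ → ℝ)}
    (hdual : ∀ x ∈ K, ∀ y ∈ K, 0 ≤ x ⬝ᵥ y) {u : κ → ℝ} (hu : u ∈ interior K) :
    ∃ ε, 0 < ε ∧ ∀ y ∈ K, ε * ‖y‖ ≤ u ⬝ᵥ y := by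
  obtain ⟨ε, hε, hball⟩ := Metric.nhds_basis_closedBall.mem_iff.1 (mem_interior_iff_mem_nhds.1 hu)
  refine ⟨ε, hε, fun y hy => ?_⟩
  rw [← le_div_iff₀' hε]
  have hi : ∀ (t : ℝ) i, |t| ≤ 1 → ε * (t * y i) ≤ u ⬝ᵥ y := by
    intro t i ht
    -- A perturbation of u by at most ε in one coordinate stays in K; pairing it with y bounds that
    -- coordinate of y.
    have hmem : u - Pi.single i (ε * t) ∈ K := hball (by
      rw [mem_closedBall_iff_norm, sub_sub_cancel_left, norm_neg, Pi.norm_single, Real.norm_eq_abs,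
        abs_mul, abs_of_pos hε]
      nlinarith)
    have := hdual _ hmem y hy
    rw [sub_dotProduct, single_dotProduct] at this
    linarith
  have h0 : 0 ≤ u ⬝ᵥ y := hdual u (interior_subset hu) y hy
  refine (pi_norm_le_iff_of_nonneg (div_nonneg h0 hε.le)).2 fun i => ?_
  rw [le_div_iff₀' hε, Real.norm_eq_abs]
  rcases abs_cases (y i) with ⟨h, _⟩ | ⟨h, _⟩
  · have := hi 1 i (by simp)
    rwa [h, ← one_mul (y i)]
  · have := hi (-1) i (by simp)
    rwa [h, ← neg_one_mul]

end Duality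

end SurfaceDOT

namespace SurfaceDOT

variable {V T : Type*} [Fintype V] [DecidableEq V] [Fintype T] [DecidableEq T]

/-! ### Existence of a solution of the KKT system -/

namespace TriMesh

/-- The linear part of the conic constraint `𝒯(ℬℱ𝒜φ + d) ∈ ℚ`. -/
noncomputable def conicMap (M : TriMesh V T) (N : ℕ) : (PhiIdx V N → ℝ) →ₗ[ℝ] (M.TIdx N → ℝ) :=
  (M.opT N).mulVecLin.comp ((opBF V T N).comp (M.opA N).mulVecLin)

/-- Slater's condition for the primal program. -/
lemma exists_primal_slater (M : TriMesh V T) {N : ℕ} (hN : 0 < N) :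
    ∃ φ, M.conicMap N φ + M.opT N *ᵥ shift V T N ∈ interior (M.coneQ N) := by
  -- Slope -1 in time and constant in space: each block of 𝒯z has head 1 - (-1) = 2 and zero tail,
  -- its last entry being -1 + 1.
  let φ : PhiIdx V N → ℝ := fun p => -(p.1 : ℝ) / N
  have hN' : (N : ℝ) ≠ 0 := by positivity
  have h1 : ∀ p, (M.opA N *ᵥ φ) (Sum.inl p) = -1 := by
    rintro ⟨j, v⟩
    rw [opA_mulVec_inl]
    simp only [φ, Fin.val_succ, Fin.val_castSucc, Nat.cast_add, Nat.cast_one]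
    field_simp
    ring
  have h2 : (fun b => (M.opA N *ᵥ φ) (Sum.inr b)) = 0 := by
    funext ⟨k, x⟩
    rw [opA_mulVec_inr]
    exact congrFun (M.spaceGrad_mulVec_const (-(k : ℝ) / N)) x
  set z := opBF V T N (M.opA N *ᵥ φ) + shift V T N with hz
  have z1 : ∀ p, z (Sum.inl p) = 2 := fun p => by
    rw [hz, Pi.add_apply, opBF_inl, h1]; simp [shift]; norm_num
  have z2 : ∀ a, z (Sum.inr (Sum.inl a)) = 0 := fun a => by
    rw [hz, Pi.add_apply, opBF_inr_inl, h2]; simp [shift]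
  have z3 : ∀ p, z (Sum.inr (Sum.inr p)) = 0 := fun p => by
    rw [hz, Pi.add_apply, opBF_inr_inr, h1]; simp [shift]
  have e : M.conicMap N φ + M.opT N *ᵥ shift V T N = M.opT N *ᵥ z := by
    rw [hz, Matrix.mulVec_add]; rfl
  refine ⟨φ, ?_⟩
  rw [e]
  refine M.mem_interior_coneQ fun p => ?_
  have t1 : (M.opT N *ᵥ z) ⟨p, Sum.inl ()⟩ = 2 := by
    rw [opT_mulVec]; exact (one_mul _).trans (z1 p)
  have t2 : ∀ i, (M.opT N *ᵥ z) ⟨p, Sum.inr i⟩ = 0 := by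
    rintro (⟨s, ⟨i, f⟩, d⟩ | _) <;> rw [opT_mulVec]
    · exact mul_eq_zero_of_right _ (z2 _)
    · exact mul_eq_zero_of_right _ (z3 _)
  simp [t1, t2]

/-- Every pair of densities is joined by a momentum field together with a positive constant
density. -/
lemma exists_positive_flow (M : TriMesh V T) {N : ℕ} (hN : 0 < N) {μ₀ μ₁ : V → ℝ}
    (hμ₀ : M.IsDensity μ₀) (hμ₁ : M.IsDensity μ₁) :
    ∃ (δ : ℝ) (m : CT T N → ℝ), 0 < δ ∧ ∀ φ,
      (M.WcV N *ᵥ costVec N μ₀ μ₁) ⬝ᵥ φ =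
        Sum.elim (fun _ => -δ) m ⬝ᵥ (M.opA N *ᵥ φ) := by
  obtain ⟨v₀⟩ := M.connected.nonempty
  have hN' : (0 : ℝ) < N := by positivity
  have hV : (0 : ℝ) < Fintype.card V := by
    have : 0 < Fintype.card V := Fintype.card_pos_iff.2 ⟨v₀⟩
    positivity
  -- Mass per vertex of the intermediate state. The momenta m₀ and m₁ compare it with the end
  -- densities and act only at times 0 and N; in between the density is at rest.
  set κ : ℝ := 1 / Fintype.card V with hκ
  have hsum : ∑ _v : V, κ = 1 := by
    rw [Finset.sum_const, Finset.card_univ, nsmul_eq_mul, hκ, mul_one_div_cancel hV.ne']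
  obtain ⟨m₀, hm₀⟩ := M.exists_divergence_eq (fun v => M.vertexArea v * μ₀ v - κ) (by
    rw [Finset.sum_sub_distrib, hμ₀.2, hsum, sub_self])
  obtain ⟨m₁, hm₁⟩ := M.exists_divergence_eq (fun v => M.vertexArea v * μ₁ v - κ) (by
    rw [Finset.sum_sub_distrib, hμ₁.2, hsum, sub_self])
  refine ⟨κ / N, fun b => (if b.1 = 0 then m₀ b.2 else 0) -
    (if b.1 = Fin.last N then m₁ b.2 else 0), by positivity, fun φ => ?_⟩
  have hA : ∀ p : StV V N, (M.opA N *ᵥ φ) (Sum.inl p) =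
      N * (φ (p.1.succ, p.2) - φ (p.1.castSucc, p.2)) := fun p => M.opA_mulVec_inl N φ p.1 p.2
  have hB : ∀ b : CT T N, (M.opA N *ᵥ φ) (Sum.inr b) =
      (M.spaceGrad *ᵥ fun v => φ (b.1, v)) b.2 := fun b => M.opA_mulVec_inr N φ b.1 b.2
  have htele : ∀ v, ∑ j : Fin N, (φ (j.succ, v) - φ (j.castSucc, v)) =
      φ (Fin.last N, v) - φ (0, v) := by
    intro v
    rw [Finset.sum_sub_distrib]
    have e1 := Fin.sum_univ_succ fun k : Fin (N + 1) => φ (k, v)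
    have e2 := Fin.sum_univ_castSucc fun k : Fin (N + 1) => φ (k, v)
    linarith
  have g0 := hm₀ fun v => φ (0, v)
  have g1 := hm₁ fun v => φ (Fin.last N, v)
  rw [M.WcV_mulVec_costVec_dotProduct hN]
  have hleft : ∑ p : StV V N, -(κ / N) * (N * (φ (p.1.succ, p.2) - φ (p.1.castSucc, p.2))) =
      ∑ v, κ * φ (0, v) - ∑ v, κ * φ (Fin.last N, v) := by
    rw [Fintype.sum_prod_type_right, ← Finset.sum_sub_distrib]
    refine Finset.sum_congr rfl fun v _ => ?_
    rw [← Finset.mul_sum, ← Finset.mul_sum, htele]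
    field_simp
    ring
  have hright : ∑ b : CT T N, ((if b.1 = 0 then m₀ b.2 else 0) -
      (if b.1 = Fin.last N then m₁ b.2 else 0)) * (M.spaceGrad *ᵥ fun v => φ (b.1, v)) b.2 =
      m₀ ⬝ᵥ (M.spaceGrad *ᵥ fun v => φ (0, v)) -
        m₁ ⬝ᵥ (M.spaceGrad *ᵥ fun v => φ (Fin.last N, v)) := by
    rw [Fintype.sum_prod_type]
    simp only [sub_mul, Finset.sum_sub_distrib, ite_mul, zero_mul]
    rw [Finset.sum_eq_single_of_mem (0 : Fin (N + 1)) (Finset.mem_univ _)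
      (fun k _ hk => by simp [hk]), Finset.sum_eq_single_of_mem (Fin.last N) (Finset.mem_univ _)
      (fun k _ hk => by simp [hk])]
    simp [dotProduct]
  simp only [dotProduct, sub_mul, Finset.sum_sub_distrib] at g0 g1 hright
  simp only [dotProduct, Fintype.sum_sum_type, Sum.elim_inl, Sum.elim_inr, hA, hB, sub_mul,
    Finset.sum_sub_distrib]
  rw [hleft, hright, g0, g1]
  ring

/-- Slater's condition for the dual program. -/
lemma exists_dual_slater (M : TriMesh V T) {N : ℕ} (hN : 0 < N) {μ₀ μ₁ : V → ℝ}
    (hμ₀ : M.IsDensity μ₀) (hμ₁ : M.IsDensity μ₁) :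
    ∃ u ∈ interior (M.coneQ N), ∀ φ,
      (M.WcV N *ᵥ costVec N μ₀ μ₁) ⬝ᵥ φ = u ⬝ᵥ M.conicMap N φ := by
  obtain ⟨δ, m, hδ, hflow⟩ := M.exists_positive_flow hN hμ₀ hμ₁
  -- The factor √3 compensates the √3/3 in ℬ.
  obtain ⟨w, hw⟩ := exists_transpose_mulVec_eq (opFtilde T N) (√3 • m) (fun x hx => by
    rw [opFtilde_mulVec_eq_zero hN hx, dotProduct_zero])
  let tail : StV V N → ℝ := fun p => ∑ b : Fin 2 × (Σ i : Fin 3, {f : T // M.vert f i = p.2}) × Fin 3,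
    (w ((b.1, b.2.1.1), (p.1, (b.2.1.2.1, b.2.2))) /
      √(M.area b.2.1.2.1 / M.vertexArea p.2)) ^ 2
  have htail : ∀ p, 0 ≤ tail p := fun p => Finset.sum_nonneg fun _ _ => sq_nonneg _
  -- Large enough for (κ + δ)² = κ² + 2δκ + δ² to exceed κ² + `tail p` strictly in every block.
  set κ : ℝ := (∑ p, tail p) / (2 * δ)
  have hκ0 : 0 ≤ κ := div_nonneg (Finset.sum_nonneg fun p _ => htail p) (by positivity)
  have hκ : ∀ p, tail p ≤ 2 * δ * κ := fun p => by
    rw [mul_div_cancel₀ _ (by positivity)]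
    exact Finset.single_le_sum (fun p _ => htail p) (Finset.mem_univ p)
  -- Through ℬ the outer entries contribute -(κ + δ) + κ = -δ, so κ is free to move the vector into
  -- the interior.
  let ω : ZIdx V T N → ℝ := Sum.elim (fun _ => κ + δ) (Sum.elim w fun _ => κ)
  refine ⟨fun r => ω (M.tEquiv N r) / M.tCoef N r, M.mem_interior_coneQ fun p => ?_, fun φ => ?_⟩
  · have e0 : ω (M.tEquiv N ⟨p, Sum.inl ()⟩) / M.tCoef N ⟨p, Sum.inl ()⟩ = κ + δ := div_one _
    have e1 : ∑ i, (ω (M.tEquiv N ⟨p, Sum.inr i⟩) / M.tCoef N ⟨p, Sum.inr i⟩) ^ 2 =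
        tail p + κ ^ 2 := by
      rw [Fintype.sum_sum_type]
      congr 1
      exact (Fintype.sum_unique _).trans (congrArg (· ^ 2) (div_one κ))
    rw [e0, e1]
    constructor
    · nlinarith [hκ p]
    · positivity
  · have e : M.conicMap N φ = M.opT N *ᵥ opBF V T N (M.opA N *ᵥ φ) := rfl
    rw [hflow, e, Matrix.dotProduct_mulVec _ (M.opT N), ← Matrix.mulVec_transpose,
      M.opT_transpose_mulVec_div]
    set q := M.opA N *ᵥ φ
    have hmid : ∑ a, w a * (√3 / 3 * (opFtilde T N *ᵥ fun b => q (Sum.inr b)) a) =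
        ∑ b, m b * q (Sum.inr b) := by
      have h1 : w ⬝ᵥ (opFtilde T N *ᵥ fun b => q (Sum.inr b)) =
          (√3 • m) ⬝ᵥ fun b => q (Sum.inr b) := by
        rw [Matrix.dotProduct_mulVec, ← Matrix.mulVec_transpose, hw]
      rw [smul_dotProduct, smul_eq_mul] at h1
      have h3 : √3 * √3 = (3 : ℝ) := Real.mul_self_sqrt (by norm_num)
      calc _ = √3 / 3 * (w ⬝ᵥ (opFtilde T N *ᵥ fun b => q (Sum.inr b))) := by
            rw [dotProduct, Finset.mul_sum]
            exact Finset.sum_congr rfl fun a _ => by ring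
        _ = (√3 * √3) / 3 * (m ⬝ᵥ fun b => q (Sum.inr b)) := by rw [h1]; ring
        _ = _ := by rw [h3, div_self (by norm_num), one_mul]; rfl
    simp only [dotProduct, Fintype.sum_sum_type, Sum.elim_inl, Sum.elim_inr, ω, opBF_inl,
      opBF_inr_inr, opBF_inr_inl]
    rw [hmid, ← Finset.mul_sum, ← Finset.mul_sum, ← Finset.mul_sum, Finset.sum_neg_distrib]
    ring

/-- The KKT system has a solution. -/
theorem exists_isKKT (M : TriMesh V T) {N : ℕ} (hN : 0 < N) {μ₀ μ₁ : V → ℝ}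
    (hμ₀ : M.IsDensity μ₀) (hμ₁ : M.IsDensity μ₁) :
    ∃ φ z q α β, M.IsKKT N μ₀ μ₁ φ z q α β := by
  classical
  obtain ⟨φ₀, hφ₀⟩ := M.exists_primal_slater hN
  obtain ⟨u, hu, hℓu⟩ := M.exists_dual_slater hN hμ₀ hμ₁
  obtain ⟨ε, hε, hcoer⟩ := exists_coercive_of_mem_interior
    (fun x hx y hy => M.dotProduct_nonneg_of_mem_coneQ hx hy) hu
  -- The dual Slater point u represents the cost and yields a minimizer; the primal one φ₀ then
  -- yields its multiplier.
  obtain ⟨φ, hφ, hmin⟩ := exists_conic_minimizer (M.conicMap N) (M.opT N *ᵥ shift V T N)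
    (M.isClosed_coneQ N) (dotProductEquiv ℝ _ u) hε hcoer (interior_subset hφ₀)
  obtain ⟨f, hfK, hf0, hf⟩ := exists_conic_multiplier
    (dotProductEquiv ℝ _ (M.WcV N *ᵥ costVec N μ₀ μ₁)) (M.conicMap N)
    (M.opT N *ᵥ shift V T N) (M.convex_coneQ N) (fun y hy c hc => M.smul_mem_coneQ hy hc) hφ₀ hφ
    (fun φ' h' => by
      have := hmin φ' h'
      simp only [dotProductEquiv_apply_apply] at this ⊢
      rwa [hℓu, hℓu])
  set ω := (dotProductEquiv ℝ _).symm (f : (M.TIdx N → ℝ) →ₗ[ℝ] ℝ)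
  have hω : ∀ y, f y = ω ⬝ᵥ y := fun y =>
    (LinearMap.congr_fun ((dotProductEquiv ℝ _).apply_symm_apply
      (f : (M.TIdx N → ℝ) →ₗ[ℝ] ℝ)) y).symm
  have hωK : ω ∈ M.coneQ N := M.mem_coneQ_of_forall_dotProduct_nonneg fun y hy => by
    rw [← hω]; exact hfK y hy
  set q := M.opA N *ᵥ φ with hq
  set z := opBF V T N q + shift V T N with hz
  have hTz : M.opT N *ᵥ z = M.conicMap N φ + M.opT N *ᵥ shift V T N := by
    rw [hz, Matrix.mulVec_add]; rfl
  have hβ : ∀ w, M.Wz N *ᵥ ((M.wz N)⁻¹ * w) = w := fun w => by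
    rw [Wz_mulVec]
    exact funext fun a => mul_inv_cancel_left₀ (M.wz_pos hN a).ne' _
  have hα : ∀ w, M.Wq N *ᵥ ((M.wq N)⁻¹ * w) = w := fun w => by
    rw [Wq_mulVec]
    exact funext fun a => mul_inv_cancel_left₀ (M.wq_pos hN a).ne' _
  set w := (M.opT N)ᵀ *ᵥ ω with hw
  refine ⟨φ, z, q, (M.wq N)⁻¹ * -((opF V T N)ᵀ *ᵥ ((opB V T N)ᵀ *ᵥ w)), (M.wz N)⁻¹ * w,
    rfl, rfl, ?_, ?_, ?_, ?_, ?_⟩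
  · rw [hα]
    refine dotProduct_eq _ _ fun x => ?_
    have h1 := hf x
    rw [dotProductEquiv_apply_apply, hω] at h1
    have e : M.conicMap N x = M.opT N *ᵥ (opB V T N *ᵥ (opF V T N *ᵥ (M.opA N *ᵥ x))) := rfl
    rw [e, Matrix.dotProduct_mulVec, ← Matrix.mulVec_transpose, ← hw, Matrix.dotProduct_mulVec,
      ← Matrix.mulVec_transpose, Matrix.dotProduct_mulVec, ← Matrix.mulVec_transpose,
      Matrix.dotProduct_mulVec, ← Matrix.mulVec_transpose] at h1
    rw [add_dotProduct, Matrix.mulVec_neg, neg_dotProduct, zero_dotProduct, h1, add_neg_cancel]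
  · rw [hα, hβ, neg_add_cancel]
  · rw [hTz]; exact hφ
  · rw [hβ]; exact ⟨ω, hωK, rfl⟩
  · have h1 : wInner (M.Wz N) ((M.wz N)⁻¹ * w) z = w ⬝ᵥ z := by
      rw [wInner, Wz_mulVec]
      refine Finset.sum_congr rfl fun a _ => ?_
      have := (M.wz_pos hN a).ne'
      simp only [Pi.mul_apply, Pi.inv_apply]
      field_simp
    rw [h1, hw, Matrix.mulVec_transpose, ← Matrix.dotProduct_mulVec, hTz, ← hω, hf0]

end TriMesh

end SurfaceDOT

namespace SurfaceDOT

variable {V T : Type*} [Fintype V] [DecidableEq V] [Fintype T] [DecidableEq T]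

/-! ### The augmented Lagrangian method as an alternating direction method in a Euclidean space -/

lemma indicatorFn_of_mem {X : Type*} {S : Set X} {x : X} (h : x ∈ S) : indicatorFn S x = 0 :=
  if_pos h

lemma indicatorFn_of_notMem {X : Type*} {S : Set X} {x : X} (h : x ∉ S) : indicatorFn S x = ⊤ :=
  if_neg h

/-- On a subspace both s + x and s - x are admissible test points. -/
lemma mem_orthogonal_of_forall_inner_nonneg {Y : Type*} [NormedAddCommGroup Y]
    [InnerProductSpace ℝ Y] {R : Submodule ℝ Y} {s v : Y} (hs : s ∈ R)
    (h : ∀ x ∈ R, 0 ≤ inner ℝ (x - s) v) : v ∈ Rᗮ := by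
  refine (Submodule.mem_orthogonal R v).2 fun x hx => ?_
  have h1 := h (s + x) (R.add_mem hs hx)
  have h2 := h (s - x) (R.sub_mem hs hx)
  rw [add_sub_cancel_left] at h1
  rw [sub_sub_cancel_left, inner_neg_left] at h2
  linarith

namespace TriMesh

lemma wInner_Wq (M : TriMesh V T) (N : ℕ) (x y : QIdx V T N → ℝ) :
    wInner (M.Wq N) x y = ∑ a, M.wq N a * (x a * y a) := by
  rw [wInner, Wq_mulVec]
  exact Finset.sum_congr rfl fun a _ => mul_left_comm _ _ _

lemma wInner_Wz (M : TriMesh V T) (N : ℕ) (x y : ZIdx V T N → ℝ) :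
    wInner (M.Wz N) x y = ∑ a, M.wz N a * (x a * y a) := by
  rw [wInner, Wz_mulVec]
  exact Finset.sum_congr rfl fun a _ => mul_left_comm _ _ _

/-- The pairs `(α, β)` with the inner product `⟨·,·⟩_q + ⟨·,·⟩_z`, as a Euclidean space. -/
noncomputable def embed (M : TriMesh V T) {N : ℕ} (hN : 0 < N) :
    ((QIdx V T N → ℝ) × (ZIdx V T N → ℝ)) ≃ₗ[ℝ]
      EuclideanSpace ℝ (QIdx V T N ⊕ ZIdx V T N) where
  toFun x := WithLp.toLp 2
    (Sum.elim (fun a => √(M.wq N a) * x.1 a) (fun a => √(M.wz N a) * x.2 a))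
  invFun p := (fun a => p (Sum.inl a) / √(M.wq N a), fun a => p (Sum.inr a) / √(M.wz N a))
  map_add' x y := by
    ext (a | a) <;> simp [mul_add]
  map_smul' c x := by
    ext (a | a) <;> simp [mul_left_comm]
  left_inv x := by
    refine Prod.ext (funext fun a => ?_) (funext fun a => ?_)
    · exact mul_div_cancel_left₀ _ (Real.sqrt_pos.2 (M.wq_pos hN a)).ne'
    · exact mul_div_cancel_left₀ _ (Real.sqrt_pos.2 (M.wz_pos hN a)).ne'
  right_inv p := by
    ext (a | a)
    · exact mul_div_cancel₀ _ (Real.sqrt_pos.2 (M.wq_pos hN a)).ne'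
    · exact mul_div_cancel₀ _ (Real.sqrt_pos.2 (M.wz_pos hN a)).ne'

variable {N : ℕ} (hN : 0 < N)

lemma inner_embed (M : TriMesh V T) (x y : (QIdx V T N → ℝ) × (ZIdx V T N → ℝ)) :
    inner ℝ (M.embed hN x) (M.embed hN y) =
      wInner (M.Wq N) x.1 y.1 + wInner (M.Wz N) x.2 y.2 := by
  rw [wInner_Wq, wInner_Wz, PiLp.inner_apply, Fintype.sum_sum_type]
  congr 1
  · refine Finset.sum_congr rfl fun a _ => ?_
    change √(M.wq N a) * y.1 a * (√(M.wq N a) * x.1 a) = _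
    linear_combination x.1 a * y.1 a * Real.mul_self_sqrt (M.wq_pos hN a).le
  · refine Finset.sum_congr rfl fun a _ => ?_
    change √(M.wz N a) * y.2 a * (√(M.wz N a) * x.2 a) = _
    linear_combination x.2 a * y.2 a * Real.mul_self_sqrt (M.wz_pos hN a).le

/-- The set of all `(𝒜φ, z)` with `𝒯z ∈ ℚ`. -/
def primalSet (M : TriMesh V T) : Set (EuclideanSpace ℝ (QIdx V T N ⊕ ZIdx V T N)) :=
  {p | ((M.embed hN).symm p).1 ∈ LinearMap.range (M.opA N).mulVecLin ∧
    M.opT N *ᵥ ((M.embed hN).symm p).2 ∈ M.coneQ N}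

/-- The embedding of `q` as `(q, ℬℱq)`. -/
noncomputable def graphMap (M : TriMesh V T) :
    (QIdx V T N → ℝ) →ₗ[ℝ] EuclideanSpace ℝ (QIdx V T N ⊕ ZIdx V T N) :=
  (M.embed hN).toLinearMap.comp (LinearMap.id.prod (opBF V T N))

lemma graphMap_apply (M : TriMesh V T) (q : QIdx V T N → ℝ) :
    M.graphMap hN q = M.embed hN (q, opBF V T N q) := rfl

/-- Restricting φ to rge 𝒜* loses nothing, because 𝒜𝒜* and 𝒜 have the same range. -/
lemma mem_primalSet_iff (M : TriMesh V T) (p : EuclideanSpace ℝ (QIdx V T N ⊕ ZIdx V T N)) :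
    p ∈ M.primalSet hN ↔ ∃ w z, M.opT N *ᵥ z ∈ M.coneQ N ∧
      M.embed hN (M.opA N *ᵥ ((M.opA N)ᵀ *ᵥ w), z) = p := by
  constructor
  · rintro ⟨⟨φ, hφ⟩, hz⟩
    obtain ⟨w, hw⟩ := exists_mulVec_transpose_eq (M.opA N) φ
    refine ⟨w, _, hz, ?_⟩
    rw [hw]
    exact ((M.embed hN).symm_apply_eq.1
      (show (M.embed hN).symm p = (M.opA N *ᵥ φ, _) from Prod.ext hφ.symm rfl)).symm
  · rintro ⟨w, z, hz, rfl⟩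
    refine ⟨?_, ?_⟩
    · rw [LinearEquiv.symm_apply_apply]; exact ⟨_, rfl⟩
    · rwa [LinearEquiv.symm_apply_apply]

lemma embed_mem_primalSet (M : TriMesh V T) {φ : PhiIdx V N → ℝ} {z : ZIdx V T N → ℝ}
    (hz : M.opT N *ᵥ z ∈ M.coneQ N) : M.embed hN (M.opA N *ᵥ φ, z) ∈ M.primalSet hN := by
  refine ⟨?_, ?_⟩
  · rw [LinearEquiv.symm_apply_apply]; exact ⟨_, rfl⟩
  · rwa [LinearEquiv.symm_apply_apply]

lemma isClosed_primalSet (M : TriMesh V T) : IsClosed (M.primalSet hN) := by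
  have hc : Continuous (M.embed hN).symm :=
    (M.embed hN).symm.toLinearMap.continuous_of_finiteDimensional
  exact ((Submodule.closed_of_finiteDimensional _).preimage (continuous_fst.comp hc)).inter
    ((M.isClosed_coneQ N).preimage
      ((M.opT N).mulVecLin.continuous_of_finiteDimensional.comp (continuous_snd.comp hc)))

lemma convex_primalSet (M : TriMesh V T) : Convex ℝ (M.primalSet hN) := by
  rintro p ⟨hp1, hp2⟩ p' ⟨hp1', hp2'⟩ a b ha hb hab
  refine ⟨?_, ?_⟩
  · rw [map_add, map_smul, map_smul]
    exact Submodule.add_mem _ (Submodule.smul_mem _ _ hp1) (Submodule.smul_mem _ _ hp1')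
  · rw [map_add, map_smul, map_smul]
    change M.opT N *ᵥ (a • _ + b • _) ∈ _
    rw [Matrix.mulVec_add, Matrix.mulVec_smul, Matrix.mulVec_smul]
    exact M.convex_coneQ N hp2 hp2' ha hb hab

variable (M : TriMesh V T) {μ₀ μ₁ : V → ℝ} {αs : QIdx V T N → ℝ}
  (hαs : M.WcV N *ᵥ costVec N μ₀ μ₁ + (M.opA N)ᵀ *ᵥ (M.Wq N *ᵥ αs) = 0)

include hαs

/-- Stationarity in φ makes the cost depend on 𝒜φ alone; this puts the linear term g of the abstract
method in the Euclidean space. -/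
lemma wInner_costVec (φ : PhiIdx V N → ℝ) :
    wInner (M.WcV N) (costVec N μ₀ μ₁) φ = wInner (M.Wq N) (M.opA N *ᵥ φ) (-αs) := by
  have hsymm : (M.WcV N)ᵀ = M.WcV N := by
    unfold WcV
    rw [Matrix.transpose_smul, ← Matrix.kroneckerMap_transpose, Matrix.diagonal_transpose,
      Matrix.transpose_one]
  rw [wInner, wInner, Matrix.dotProduct_mulVec, ← Matrix.mulVec_transpose, hsymm,
    eq_neg_of_add_eq_zero_left hαs, Matrix.mulVec_neg, dotProduct_neg, neg_dotProduct,
    Matrix.mulVec_transpose, ← Matrix.dotProduct_mulVec, dotProduct_comm]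

include hN

/-- The augmented Lagrangian in Euclidean coordinates. -/
lemma augLagrangian_eq (σ : ℝ) (φ : PhiIdx V N → ℝ) (z : ZIdx V T N → ℝ)
    (q α : QIdx V T N → ℝ) (β : ZIdx V T N → ℝ) :
    M.augLagrangian N μ₀ μ₁ σ φ z q α β =
      ((inner ℝ (M.embed hN (M.opA N *ᵥ φ, z)) (M.embed hN (-αs, 0)) +
        inner ℝ (M.embed hN (M.opA N *ᵥ φ, z) - M.graphMap hN q - M.embed hN (0, shift V T N))
          (M.embed hN (α, β)) +
        σ / 2 * ‖M.embed hN (M.opA N *ᵥ φ, z) - M.graphMap hN q -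
          M.embed hN (0, shift V T N)‖ ^ 2 : ℝ) : EReal) +
      indicatorFn (M.coneQ N) (M.opT N *ᵥ z) := by
  have e : M.embed hN (M.opA N *ᵥ φ, z) - M.graphMap hN q - M.embed hN (0, shift V T N) =
      M.embed hN (M.opA N *ᵥ φ - q, z - opB V T N *ᵥ (opF V T N *ᵥ q) - shift V T N) := by
    rw [graphMap_apply, ← map_sub, ← map_sub]
    congr 1
    refine Prod.ext ?_ rfl
    simp
  rw [e, ← real_inner_self_eq_norm_sq, inner_embed, inner_embed, inner_embed, augLagrangian,
    M.wInner_costVec hαs]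
  congr 2
  have h0 : wInner (M.Wz N) z 0 = 0 := by rw [wInner, Matrix.mulVec_zero, dotProduct_zero]
  dsimp only
  rw [h0]
  ring

/-- For fixed q and multipliers, all terms that do not depend on (φ, z) are split off, so minimizers
can be compared through `quad`. -/
lemma augLagrangian_eq_quad_left (σ : ℝ) {φ : PhiIdx V N → ℝ} {z : ZIdx V T N → ℝ}
    (hz : M.opT N *ᵥ z ∈ M.coneQ N) (q α : QIdx V T N → ℝ) (β : ZIdx V T N → ℝ) :
    M.augLagrangian N μ₀ μ₁ σ φ z q α β =
      ((quad σ (M.embed hN (-αs, 0) + M.embed hN (α, β))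
        (M.graphMap hN q + M.embed hN (0, shift V T N)) (M.embed hN (M.opA N *ᵥ φ, z)) -
        inner ℝ (M.graphMap hN q + M.embed hN (0, shift V T N)) (M.embed hN (α, β)) : ℝ) :
        EReal) := by
  rw [M.augLagrangian_eq hN hαs, indicatorFn_of_mem hz, add_zero, quad, sub_sub, inner_add_right,
    inner_sub_left]
  congr 1
  ring

lemma augLagrangian_eq_quad_right (σ : ℝ) {φ : PhiIdx V N → ℝ} {z : ZIdx V T N → ℝ}
    (hz : M.opT N *ᵥ z ∈ M.coneQ N) (q α : QIdx V T N → ℝ) (β : ZIdx V T N → ℝ) :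
    M.augLagrangian N μ₀ μ₁ σ φ z q α β =
      ((quad σ (-M.embed hN (α, β))
        (M.embed hN (M.opA N *ᵥ φ, z) - M.embed hN (0, shift V T N)) (M.graphMap hN q) +
        (inner ℝ (M.embed hN (M.opA N *ᵥ φ, z)) (M.embed hN (-αs, 0)) +
        inner ℝ (M.embed hN (M.opA N *ᵥ φ, z) - M.embed hN (0, shift V T N))
          (M.embed hN (α, β))) : ℝ) : EReal) := by
  rw [M.augLagrangian_eq hN hαs, indicatorFn_of_mem hz, add_zero, quad, sub_right_comm,
    norm_sub_rev, inner_neg_right, inner_sub_left _ (M.graphMap hN q)]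
  congr 1
  ring

/-- The minimization in `(φ, z)` as a variational inequality. -/
lemma isArgMin_phi_z_iff {σ : ℝ} (hσ : 0 < σ) (φ : PhiIdx V N → ℝ) (z : ZIdx V T N → ℝ)
    (q α : QIdx V T N → ℝ) (β : ZIdx V T N → ℝ) :
    IsArgMin (fun p : (PhiIdx V N → ℝ) × (ZIdx V T N → ℝ) =>
      M.augLagrangian N μ₀ μ₁ σ p.1 p.2 q α β)
      {p | p.1 ∈ Set.range fun w => (M.opA N)ᵀ *ᵥ w} (φ, z) ↔
    (φ ∈ Set.range fun w => (M.opA N)ᵀ *ᵥ w) ∧ M.opT N *ᵥ z ∈ M.coneQ N ∧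
      ∀ x ∈ M.primalSet hN, 0 ≤ inner ℝ (x - M.embed hN (M.opA N *ᵥ φ, z))
        (M.embed hN (-αs, 0) + M.embed hN (α, β) + σ • (M.embed hN (M.opA N *ᵥ φ, z) -
          M.graphMap hN q - M.embed hN (0, shift V T N))) := by
  have hcone0 : M.opT N *ᵥ (0 : ZIdx V T N → ℝ) ∈ M.coneQ N := by
    rw [Matrix.mulVec_zero]; exact M.zero_mem_coneQ N
  constructor
  · rintro ⟨hφ, hmin⟩
    have hz : M.opT N *ᵥ z ∈ M.coneQ N := by
      by_contra hz
      -- The origin has a finite value, so a minimizer cannot violate the cone constraint.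
      have h1 := hmin (0, 0) ⟨0, Matrix.mulVec_zero _⟩
      dsimp only at h1
      rw [M.augLagrangian_eq_quad_left hN hαs σ hcone0, M.augLagrangian_eq hN hαs,
        indicatorFn_of_notMem hz, EReal.coe_add_top, top_le_iff] at h1
      exact EReal.coe_ne_top _ h1
    refine ⟨hφ, hz, ?_⟩
    rw [sub_sub]
    refine (isMinOn_quad_iff (M.isClosed_primalSet hN) (M.convex_primalSet hN) hσ _ _
      (M.embed_mem_primalSet hN hz)).1 fun x hx => ?_
    obtain ⟨w, z', hz', rfl⟩ := (M.mem_primalSet_iff hN x).1 hx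
    have h1 := hmin ((M.opA N)ᵀ *ᵥ w, z') ⟨w, rfl⟩
    dsimp only at h1
    rw [M.augLagrangian_eq_quad_left hN hαs σ hz, M.augLagrangian_eq_quad_left hN hαs σ hz',
      EReal.coe_le_coe_iff] at h1
    linarith
  · rintro ⟨hφ, hz, hvar⟩
    refine ⟨hφ, ?_⟩
    rintro ⟨φ', z'⟩ -
    dsimp only
    by_cases hz' : M.opT N *ᵥ z' ∈ M.coneQ N
    · rw [sub_sub] at hvar
      have h1 := (isMinOn_quad_iff (M.isClosed_primalSet hN) (M.convex_primalSet hN) hσ _ _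
        (M.embed_mem_primalSet hN hz)).2 hvar _ (M.embed_mem_primalSet hN (φ := φ') hz')
      rw [M.augLagrangian_eq_quad_left hN hαs σ hz, M.augLagrangian_eq_quad_left hN hαs σ hz',
        EReal.coe_le_coe_iff]
      linarith
    · rw [M.augLagrangian_eq hN hαs σ φ' z', indicatorFn_of_notMem hz', EReal.coe_add_top]
      exact le_top

/-- The minimization in `q` as an orthogonality relation. -/
lemma isArgMin_q_iff {σ : ℝ} (hσ : 0 < σ) {φ : PhiIdx V N → ℝ} {z : ZIdx V T N → ℝ}
    (hz : M.opT N *ᵥ z ∈ M.coneQ N) (q α : QIdx V T N → ℝ) (β : ZIdx V T N → ℝ) :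
    IsArgMin (fun q' => M.augLagrangian N μ₀ μ₁ σ φ z q' α β) Set.univ q ↔
      M.embed hN (α, β) + σ • (M.embed hN (M.opA N *ᵥ φ, z) - M.graphMap hN q -
        M.embed hN (0, shift V T N)) ∈ (LinearMap.range (M.graphMap hN))ᗮ := by
  have hclosed := Submodule.closed_of_finiteDimensional (LinearMap.range (M.graphMap hN))
  have hconv := (LinearMap.range (M.graphMap hN)).convex
  have e : M.embed hN (α, β) + σ • (M.embed hN (M.opA N *ᵥ φ, z) - M.graphMap hN q -
      M.embed hN (0, shift V T N)) = -(-M.embed hN (α, β) + σ • (M.graphMap hN q -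
        (M.embed hN (M.opA N *ᵥ φ, z) - M.embed hN (0, shift V T N)))) := by module
  rw [e, Submodule.neg_mem_iff]
  constructor
  · rintro ⟨-, hmin⟩
    refine mem_orthogonal_of_forall_inner_nonneg (s := M.graphMap hN q) ⟨q, rfl⟩
      ((isMinOn_quad_iff hclosed hconv hσ _ _ ⟨q, rfl⟩).1 ?_)
    rintro _ ⟨q', rfl⟩
    have h1 := hmin q' trivial
    dsimp only at h1
    rw [M.augLagrangian_eq_quad_right hN hαs σ hz, M.augLagrangian_eq_quad_right hN hαs σ hz,
      EReal.coe_le_coe_iff] at h1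
    linarith
  · intro hv
    refine ⟨trivial, fun q' _ => ?_⟩
    have h1 := (isMinOn_quad_iff hclosed hconv hσ (-M.embed hN (α, β))
      (M.embed hN (M.opA N *ᵥ φ, z) - M.embed hN (0, shift V T N)) (p := M.graphMap hN q)
      ⟨q, rfl⟩).2 (fun x hx => ((Submodule.mem_orthogonal _ _).1 hv _
        (Submodule.sub_mem _ hx ⟨q, rfl⟩)).ge) _ ⟨q', rfl⟩
    dsimp only
    rw [M.augLagrangian_eq_quad_right hN hαs σ hz, M.augLagrangian_eq_quad_right hN hαs σ hz,
      EReal.coe_le_coe_iff]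
    linarith

/-- The minimization steps enter only through their optimality conditions. The unconstrained φ 0 and
z 0 do no harm, as `IsSplitting` involves p only from index 1 on. -/
lemma IsGenerated.isSplitting {σ τ : ℝ} (hσ : 0 < σ) {q₀ α₀ : QIdx V T N → ℝ}
    {β₀ : ZIdx V T N → ℝ} {φ : ℕ → PhiIdx V N → ℝ} {z : ℕ → ZIdx V T N → ℝ}
    {q α : ℕ → QIdx V T N → ℝ} {β : ℕ → ZIdx V T N → ℝ}
    (h : M.IsGenerated N μ₀ μ₁ σ τ q₀ α₀ β₀ φ z q α β) :
    IsSplitting (M.primalSet hN) (LinearMap.range (M.graphMap hN)) (M.embed hN (-αs, 0))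
      (M.embed hN (0, shift V T N)) σ τ (fun l => M.embed hN (M.opA N *ᵥ φ l, z l))
      (fun l => M.graphMap hN (q l)) (fun l => M.embed hN (α l, β l)) where
  mem l := M.embed_mem_primalSet hN
    ((M.isArgMin_phi_z_iff hN hαs hσ _ _ _ _ _).1 (h.step_phi_z l)).2.1
  opt l := ((M.isArgMin_phi_z_iff hN hαs hσ _ _ _ _ _).1 (h.step_phi_z l)).2.2
  mem_range l := ⟨_, rfl⟩
  ortho l := (M.isArgMin_q_iff hN hαs hσ
    ((M.isArgMin_phi_z_iff hN hαs hσ _ _ _ _ _).1 (h.step_phi_z l)).2.1 _ _ _).1 (h.step_q l)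
  step l := by
    rw [graphMap_apply, ← map_sub, ← map_sub, ← map_smul, ← map_add, h.step_alpha, h.step_beta]
    congr 1
    refine Prod.ext ?_ rfl
    simp

/-- One step of the algorithm can always be performed. -/
lemma exists_step {σ : ℝ} (hσ : 0 < σ) (q α : QIdx V T N → ℝ) (β : ZIdx V T N → ℝ) :
    ∃ (φ' : PhiIdx V N → ℝ) (z' : ZIdx V T N → ℝ) (q' : QIdx V T N → ℝ),
      IsArgMin (fun p : (PhiIdx V N → ℝ) × (ZIdx V T N → ℝ) =>
        M.augLagrangian N μ₀ μ₁ σ p.1 p.2 q α β)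
        {p | p.1 ∈ Set.range fun w => (M.opA N)ᵀ *ᵥ w} (φ', z') ∧
      IsArgMin (fun q'' => M.augLagrangian N μ₀ μ₁ σ φ' z' q'' α β) Set.univ q' := by
  have hcone0 : M.opT N *ᵥ (0 : ZIdx V T N → ℝ) ∈ M.coneQ N := by
    rw [Matrix.mulVec_zero]; exact M.zero_mem_coneQ N
  obtain ⟨p, hp, hvar⟩ := exists_variational (M.isClosed_primalSet hN) (M.convex_primalSet hN)
    ⟨_, M.embed_mem_primalSet hN (φ := 0) hcone0⟩ hσ
    (M.embed hN (-αs, 0) + M.embed hN (α, β)) (M.graphMap hN q + M.embed hN (0, shift V T N))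
  obtain ⟨w, z, hz, rfl⟩ := (M.mem_primalSet_iff hN p).1 hp
  obtain ⟨_, ⟨q', rfl⟩, hq'⟩ := exists_variational
    (Submodule.closed_of_finiteDimensional (LinearMap.range (M.graphMap hN)))
    (LinearMap.range (M.graphMap hN)).convex ⟨0, Submodule.zero_mem _⟩ hσ
    (-M.embed hN (α, β)) (M.embed hN (M.opA N *ᵥ ((M.opA N)ᵀ *ᵥ w), z) -
      M.embed hN (0, shift V T N))
  refine ⟨(M.opA N)ᵀ *ᵥ w, z, q', ?_, ?_⟩
  · rw [M.isArgMin_phi_z_iff hN hαs hσ, sub_sub]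
    exact ⟨⟨w, rfl⟩, hz, hvar⟩
  · rw [M.isArgMin_q_iff hN hαs hσ hz]
    have h1 := Submodule.neg_mem _ (mem_orthogonal_of_forall_inner_nonneg
      (R := LinearMap.range (M.graphMap hN)) ⟨q', rfl⟩ hq')
    convert h1 using 1
    module

lemma exists_isGenerated {σ : ℝ} (hσ : 0 < σ) (τ : ℝ) (q₀ α₀ : QIdx V T N → ℝ)
    (β₀ : ZIdx V T N → ℝ) :
    ∃ φ z q α β, M.IsGenerated N μ₀ μ₁ σ τ q₀ α₀ β₀ φ z q α β := by
  choose f g k hfg hk using M.exists_step hN hαs hσ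
  let next : (PhiIdx V N → ℝ) × (ZIdx V T N → ℝ) × (QIdx V T N → ℝ) × (QIdx V T N → ℝ) ×
      (ZIdx V T N → ℝ) → (PhiIdx V N → ℝ) × (ZIdx V T N → ℝ) × (QIdx V T N → ℝ) ×
      (QIdx V T N → ℝ) × (ZIdx V T N → ℝ) := fun s =>
    let q := s.2.2.1
    let α := s.2.2.2.1
    let β := s.2.2.2.2
    (f q α β, g q α β, k q α β,
      α + (τ * σ) • (M.opA N *ᵥ f q α β - k q α β),
      β + (τ * σ) • (g q α β - opB V T N *ᵥ (opF V T N *ᵥ k q α β) - shift V T N))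
  -- The two initial zeros are placeholders for φ and z, which `next` ignores.
  let S : ℕ → (PhiIdx V N → ℝ) × (ZIdx V T N → ℝ) × (QIdx V T N → ℝ) × (QIdx V T N → ℝ) ×
      (ZIdx V T N → ℝ) := fun l => next^[l] (0, 0, q₀, α₀, β₀)
  have hS : ∀ l, S (l + 1) = next (S l) := fun l => Function.iterate_succ_apply' _ _ _
  refine ⟨fun l => (S l).1, fun l => (S l).2.1, fun l => (S l).2.2.1, fun l => (S l).2.2.2.1,
    fun l => (S l).2.2.2.2, rfl, rfl, rfl, fun l => ?_, fun l => ?_, fun l => ?_, fun l => ?_⟩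
  · simp only [hS]; exact hfg _ _ _
  · simp only [hS]; exact hk _ _ _
  · simp only [hS]; rfl
  · simp only [hS]; rfl

/-- Varying φ alone in the variational inequality gives stationarity; varying z alone gives the dual
cone, with complementarity from the test points 0 and 2z. Orthogonality to R is stationarity in q.
-/
lemma IsSaddle.isKKT {φ : PhiIdx V N → ℝ} {z : ZIdx V T N → ℝ} {q α : QIdx V T N → ℝ}
    {β : ZIdx V T N → ℝ}
    (h : IsSaddle (M.primalSet hN) (LinearMap.range (M.graphMap hN)) (M.embed hN (-αs, 0))
      (M.embed hN (0, shift V T N)) (M.embed hN (M.opA N *ᵥ φ, z)) (M.graphMap hN q)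
      (M.embed hN (α, β))) : M.IsKKT N μ₀ μ₁ φ z q α β := by
  have hfeas := h.feas
  rw [graphMap_apply, ← map_add, (M.embed hN).injective.eq_iff] at hfeas
  have hz : M.opT N *ᵥ z ∈ M.coneQ N := by
    have := h.mem.2
    rwa [LinearEquiv.symm_apply_apply] at this
  have hopt : ∀ x z', M.opT N *ᵥ z' ∈ M.coneQ N →
      0 ≤ (M.opA N *ᵥ x) ⬝ᵥ (M.Wq N *ᵥ (α - αs)) + (z' - z) ⬝ᵥ (M.Wz N *ᵥ β) := by
    intro x z' hz'
    have h1 := h.opt _ (M.embed_mem_primalSet hN (φ := φ + x) hz')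
    rw [← map_sub, ← map_add, inner_embed] at h1
    have e1 : M.opA N *ᵥ (φ + x) - M.opA N *ᵥ φ = M.opA N *ᵥ x := by
      rw [Matrix.mulVec_add, add_sub_cancel_left]
    have e2 : -αs + α = α - αs := by abel
    simp only [Prod.mk_sub_mk, Prod.mk_add_mk, zero_add, e1, e2] at h1
    exact h1
  have hβz : ∀ z', M.opT N *ᵥ z' ∈ M.coneQ N → 0 ≤ (z' - z) ⬝ᵥ (M.Wz N *ᵥ β) := by
    intro z' hz'
    have := hopt 0 z' hz'
    rwa [Matrix.mulVec_zero, zero_dotProduct, zero_add] at this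
  have hcompl : z ⬝ᵥ (M.Wz N *ᵥ β) = 0 := by
    have h1 := hβz 0 (by rw [Matrix.mulVec_zero]; exact M.zero_mem_coneQ N)
    have h2 := hβz ((2 : ℝ) • z) (by
      rw [Matrix.mulVec_smul]; exact M.smul_mem_coneQ hz (by norm_num))
    rw [zero_sub, neg_dotProduct] at h1
    rw [two_smul, add_sub_cancel_right] at h2
    linarith
  refine ⟨(congrArg Prod.fst hfeas).trans (add_zero _), (congrArg Prod.snd hfeas).symm,
    ?_, ?_, hz, ?_, ?_⟩
  -- The cost was encoded by `αs`, so only 𝒜*𝒲_q α = 𝒜*𝒲_q αs is needed, not equality of the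
  -- multipliers.
  · have h1 : (M.opA N)ᵀ *ᵥ (M.Wq N *ᵥ (α - αs)) = 0 := by
      refine dotProduct_eq_zero _ fun x => ?_
      have h2 := hopt x z hz
      have h3 := hopt (-x) z hz
      rw [sub_self, zero_dotProduct, add_zero] at h2 h3
      rw [Matrix.mulVec_neg, neg_dotProduct] at h3
      rw [Matrix.mulVec_transpose, ← Matrix.dotProduct_mulVec, dotProduct_comm]
      linarith
    rw [Matrix.mulVec_sub, Matrix.mulVec_sub, sub_eq_zero] at h1
    rw [h1, hαs]
  · refine dotProduct_eq_zero _ fun x => ?_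
    have h1 := (Submodule.mem_orthogonal _ _).1 h.dual _ ⟨x, rfl⟩
    rw [graphMap_apply, inner_embed] at h1
    rw [add_dotProduct, Matrix.mulVec_transpose, ← Matrix.dotProduct_mulVec,
      Matrix.mulVec_transpose, ← Matrix.dotProduct_mulVec, dotProduct_comm,
      dotProduct_comm (M.Wz N *ᵥ β)]
    exact h1
  · rw [mem_image_coneQ_iff]
    intro z' hz'
    have := hβz z' hz'
    rw [sub_dotProduct, hcompl, sub_zero] at this
    rwa [dotProduct_comm]
  · have : wInner (M.Wz N) β z = wInner (M.Wz N) z β := by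
      rw [wInner_Wz, wInner_Wz]
      exact Finset.sum_congr rfl fun a _ => by ring
    rw [this]
    exact hcompl

omit hαs

/-- With the cost encoded by the point's own α, the q-components of g + y cancel, and the
variational inequality is the dual cone condition with complementarity. -/
lemma IsKKT.isSaddle {M : TriMesh V T} {φ : PhiIdx V N → ℝ} {z : ZIdx V T N → ℝ}
    {q α : QIdx V T N → ℝ} {β : ZIdx V T N → ℝ} (h : M.IsKKT N μ₀ μ₁ φ z q α β) :
    IsSaddle (M.primalSet hN) (LinearMap.range (M.graphMap hN)) (M.embed hN (-α, 0))
      (M.embed hN (0, shift V T N)) (M.embed hN (M.opA N *ᵥ φ, z)) (M.graphMap hN q)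
      (M.embed hN (α, β)) where
  mem := M.embed_mem_primalSet hN h.cone_z
  mem_range := ⟨q, rfl⟩
  feas := by
    rw [graphMap_apply, ← map_add, h.feas_q, ← h.feas_z, Prod.mk_add_mk, add_zero]
    rfl
  dual := by
    rw [Submodule.mem_orthogonal]
    rintro _ ⟨x, rfl⟩
    rw [graphMap_apply, inner_embed]
    have h1 := congrArg (· ⬝ᵥ x) h.stat_q
    rw [add_dotProduct, Matrix.mulVec_transpose, ← Matrix.dotProduct_mulVec,
      Matrix.mulVec_transpose, ← Matrix.dotProduct_mulVec, dotProduct_comm,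
      dotProduct_comm (M.Wz N *ᵥ β), zero_dotProduct] at h1
    exact h1
  opt := by
    intro x hx
    obtain ⟨w, z', hz', rfl⟩ := (M.mem_primalSet_iff hN x).1 hx
    rw [← map_sub, ← map_add, inner_embed]
    have h1 := (M.mem_image_coneQ_iff N _).1 h.cone_beta z' hz'
    have h2 := h.compl
    rw [wInner_Wz] at h2
    simp only [Prod.mk_sub_mk, Prod.mk_add_mk, neg_add_cancel, zero_add, wInner_Wq, wInner_Wz]
    rw [Wz_mulVec] at h1
    have e : ∑ a, M.wz N a * ((z' - z) a * β a) = (M.wz N * β) ⬝ᵥ z' -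
        ∑ a, M.wz N a * (β a * z a) := by
      rw [dotProduct, ← Finset.sum_sub_distrib]
      refine Finset.sum_congr rfl fun a _ => ?_
      simp only [Pi.mul_apply, Pi.sub_apply]
      ring
    rw [e, h2]
    simpa using h1

end TriMesh

end SurfaceDOT

/-! ### Convergence of Algorithm 1 -/

theorem theorem1 {V T : Type*} [Fintype V] [DecidableEq V] [Fintype T] [DecidableEq T]
    (M : SurfaceDOT.TriMesh V T) (N : ℕ) (hN : 0 < N) (μ₀ μ₁ : V → ℝ)
    (hμ₀ : M.IsDensity μ₀) (hμ₁ : M.IsDensity μ₁)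
    (σ τ : ℝ) (hσ : 0 < σ) (hτ : τ ∈ Set.Ioo (0 : ℝ) 2)
    (q₀ α₀ : SurfaceDOT.QIdx V T N → ℝ) (β₀ : SurfaceDOT.ZIdx V T N → ℝ) :
    (∃ φ z q α β, M.IsGenerated N μ₀ μ₁ σ τ q₀ α₀ β₀ φ z q α β) ∧
    ∀ φ z q α β, M.IsGenerated N μ₀ μ₁ σ τ q₀ α₀ β₀ φ z q α β →
      ∃ φ' z' q' α' β', M.IsKKT N μ₀ μ₁ φ' z' q' α' β' ∧
        Tendsto (fun l => (φ l, z l, q l, α l, β l)) atTop (𝓝 (φ', z', q', α', β')) := by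
  obtain ⟨φs, zs, qs, αs, βs, hs⟩ := M.exists_isKKT hN hμ₀ hμ₁
  refine ⟨M.exists_isGenerated hN hs.stat_phi hσ τ q₀ α₀ β₀, fun φ z q α β h => ?_⟩
  obtain ⟨p', s', y', hsad, hp, hs', hy⟩ := (SurfaceDOT.TriMesh.IsGenerated.isSplitting hN M
    hs.stat_phi hσ h).tendsto hσ hτ (M.isClosed_primalSet hN) ⟨_, _, _, hs.isSaddle hN⟩
  obtain ⟨q', rfl⟩ := hsad.mem_range
  obtain ⟨w, z', -, rfl⟩ := (M.mem_primalSet_iff hN p').1 hsad.mem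
  obtain ⟨⟨α', β'⟩, rfl⟩ := (M.embed hN).surjective y'
  refine ⟨_, z', q', α', β', SurfaceDOT.TriMesh.IsSaddle.isKKT hN M hs.stat_phi hsad, ?_⟩
  have hc : Continuous (M.embed hN).symm :=
    (M.embed hN).symm.toLinearMap.continuous_of_finiteDimensional
  have hp1 := (hc.tendsto _).comp hp
  have hs1 := (hc.tendsto _).comp hs'
  have hy1 := (hc.tendsto _).comp hy
  simp only [Function.comp_def, SurfaceDOT.TriMesh.graphMap_apply,
    LinearEquiv.symm_apply_apply] at hp1 hs1 hy1
  -- So far only 𝒜φ is known to converge; as the iterates φ (l + 1) lie in rge 𝒜*, the continuous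
  -- map P recovers them and their limit.
  obtain ⟨P, hP⟩ := SurfaceDOT.exists_leftInverse_on_range_transpose (M.opA N)
  have hφ : Tendsto φ atTop (𝓝 ((M.opA N)ᵀ *ᵥ w)) := by
    rw [← tendsto_add_atTop_iff_nat 1, ← hP w]
    refine ((P.continuous_of_finiteDimensional.tendsto _).comp hp1.fst_nhds).congr fun l => ?_
    obtain ⟨w', hw'⟩ := (h.step_phi_z l).1
    dsimp only at hw'
    simp only [Function.comp]
    rw [← hw', hP]
  exact hφ.prodMk_nhds (((tendsto_add_atTop_iff_nat 1).1 hp1.snd_nhds).prodMk_nhds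
    (hs1.fst_nhds.prodMk_nhds hy1))
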